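/- Let $(\mathbb S,\mathcal A,\mathbb P)$ be a probability space, $(\Xi,\mathscr M)$ a measurable space, $d\ge 1$, $\Omega\subseteq\mathbb R^d$ a Lebesgue measurable set of positive Lebesgue measure, and $n\in\mathbb N$. Assume that $\mathcal A$ contains $n$ pairwise disjoint events of positive probability (equivalently, $\dim L^2(\mathbb P)\ge n$). Let $\{X_\xi\}_{\xi\in\Xi}$ be a family of real-valued random fields on $\Omega$, defined over $(\mathbb S,\mathcal A,\mathbb P)$, such that $(\xi,z,\omega)\mapsto X_\xi(z)(\omega)$ is jointly measurable on $\Xi\times\Omega\times\mathbb S$ ($\Omega$ carrying its Lebesgue measurable subsets) and $$\mathbb E\int_\Omega |X_\xi(z)|^2\,dz<+\infty\qquad\text{for all }\xi\in\Xi.$$ Then there exist measurable maps $s_i:\Xi\to[0,\infty)$ and $v_i:\Xi\times\Omega\to\mathbb R$, $i=1,\dots,n$, and a family of real random variables $\{\eta_{\xi,1},\dots,\eta_{\xi,n}\}_{\xi\in\Xi}$ on $(\mathbb S,\mathcal A,\mathbb P)$ such that, for all $\xi\in\Xi$, the $\eta_{\xi,i}$ and the $v_i(\xi,\cdot)$ are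 square-integrable, $$\mathbb E[\eta_{\xi,i}\eta_{\xi,j}]=\int_\Omega v_i(\xi,z)v_j(\xi,z)\,dz=\delta_{i,j}\qquad (i,j=1,\dots,n),$$ and $$\mathbb E\int_\Omega\Big|X_\xi(z)-\sum_{i=1}^n\eta_{\xi,i}\,s_i(\xi)\,v_i(\xi,z)\Big|^2dz=\inf_{Z\in Q_n}\mathbb E\int_\Omega|X_\xi(z)-Z(z)|^2\,dz,$$ where $$Q_n=\Big\{Z=\sum_{i=1}^n a_if_i\;:\; a_i \text{ real random variables with } \mathbb E|a_i|^2<+\infty,\ f_i\in L^2(\Omega)\Big\}.$$ Furthermore, the $s_i$, $v_i$ and $\eta_{\xi,i}$ can be chosen so that, for every topology on $\Xi$ for which $\mathbb E\int_\Omega|X_\xi(z)-X_{\xi'}(z)|^2dz\to0$ whenever $\xi\to\xi'$, the maps $s_1,\dots,s_n$ are continuous. -/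

import Mathlib

open MeasureTheory Filter Topology
attribute [local instance] MeasureTheory.Measure.Subtype.measureSpace
open scoped ENNReal

/-- The mean square `𝔼 ∫_D |Y(z)|² dz` of a random field `Y` on `D`, as an element of `[0, ∞]`.
Here `ω : S` is the sample point and `D` carries its volume measure. -/
noncomputable def meanSquare {D S : Type*} [MeasureSpace D] [MeasurableSpace S]
    (P : Measure S) (Y : D → S → ℝ) : ℝ≥0∞ :=
  ∫⁻ ω, ∫⁻ z, ‖Y z ω‖ₑ ^ 2 ∂(volume : Measure D) ∂P

/-- The random fields `Z(z) = ∑ i, a i * f i z` with `n` summands, where the `a i` are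
square-integrable random variables and the `f i` are in `L²(D)`. -/
def rankFields {S : Type*} [MeasurableSpace S] (D : Type*) [MeasureSpace D]
    (P : Measure S) (n : ℕ) : Set (D → S → ℝ) :=
  {Z | ∃ (a : Fin n → S → ℝ) (f : Fin n → D → ℝ),
    (∀ i, MemLp (a i) 2 P) ∧ (∀ i, MemLp (f i) 2 (volume : Measure D)) ∧
    Z = fun z ω => ∑ i, a i ω * f i z}

/-! This is a measurable Eckart–Young theorem. Read `X ξ` as a random vector `Y ξ` in the separable
space L²(Ω), with covariance operator T = 𝔼[⟪Y,·⟫Y], which is positive and compact. If v₁,…,vₙ are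
orthonormal eigenvectors for its n largest eigenvalues λᵢ, projecting `Y` onto their span leaves the
error 𝔼‖Y‖² − ∑λᵢ. An approximation ∑ aᵢfᵢ takes values in a span of dimension at most n, so its
error is at least 𝔼‖Y‖² minus the trace of T over an orthonormal basis of that span, and Ky Fan's
inequality bounds this trace by ∑λᵢ. Put sᵢ = √λᵢ and ηᵢ = ⟪vᵢ,Y⟫/√λᵢ where λᵢ ≠ 0; the remaining ηᵢ
complete an orthonormal family, which is possible because dim L²(P) ≥ n.

The delicate point is to choose vᵢ measurably in ξ although eigenvalues may cross. If S is a
positive contraction, Sᵐx converges to a fixed vector of S, so fixed vectors arise as pointwise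
limits of measurable maps (`exists_measurable_fixed_vector`). Applying this to T compressed to the
complement of the earlier eigenvectors and divided by its norm yields the next one
(`exists_measurable_next_eigenvector`).

Continuity holds because √λₖ is a singular value, hence 1-Lipschitz in the L² distance of the fields
(`sqrt_eigenvalue_le`). -/

open scoped InnerProductSpace

/-! ### Positive operators: top eigenvector and convergence of powers -/

section PositiveOperators

variable {H : Type*} [NormedAddCommGroup H] [InnerProductSpace ℝ H]

/-- The norm of a positive operator is the supremum of its Rayleigh quotients. Were it in the
resolvent set, these would stay a fixed ε below it. Compactness turns the spectral value into an
eigenvalue. -/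
theorem ContinuousLinearMap.IsPositive.exists_eigenvector_norm [CompleteSpace H] {T : H →L[ℝ] H}
    (hT : T.IsPositive) (hc : IsCompactOperator T) (h0 : T ≠ 0) :
    ∃ u : H, u ≠ 0 ∧ T u = ‖T‖ • u := by
  have hn : ‖T‖ ≠ 0 := norm_ne_zero_iff.2 h0
  have : Nontrivial H := by
    by_contra h
    rw [not_nontrivial_iff_subsingleton] at h
    exact h0 (ContinuousLinearMap.ext fun x => Subsingleton.elim _ _)
  have hspec : ‖T‖ ∈ spectrum ℝ T := by
    by_contra h
    obtain ⟨ε, hε, hle⟩ := T.rayleighQuotient_le_of_norm_mem_resolventSet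
      (𝕜 := ℝ) (by simpa [spectrum] using h)
    have h1 : ‖T‖ ≤ ‖T‖ - ε := by
      conv_lhs => rw [T.norm_eq_iSup_rayleighQuotient hT.isSymmetric]
      refine ciSup_le fun x => ?_
      rw [abs_of_nonneg]
      · exact hle x
      · unfold ContinuousLinearMap.rayleighQuotient
        have := hT.re_inner_nonneg_left x
        rw [ContinuousLinearMap.reApplyInnerSelf_apply]
        positivity
    linarith
  obtain ⟨u, hu⟩ := ((hc.hasEigenvalue_iff_mem_spectrum hn).2 hspec).exists_hasEigenvector
  exact ⟨u, hu.2, hu.apply_eq_smul⟩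

/-- This is S² ≤ S for a positive contraction, obtained by testing positivity on y − Sy. -/
theorem ContinuousLinearMap.IsPositive.sq_norm_apply_le {S : H →L[ℝ] H} (hS : S.IsPositive)
    (h1 : ‖S‖ ≤ 1) (y : H) : ‖S y‖ ^ 2 ≤ ⟪S y, y⟫_ℝ := by
  have h := hS.inner_nonneg_left (y - S y)
  have h2 : ⟪S (S y), S y⟫_ℝ ≤ ‖S y‖ ^ 2 := by
    refine (real_inner_le_norm _ _).trans ?_
    have := S.le_of_opNorm_le h1 (S y)
    nlinarith [norm_nonneg (S y)]
  have h3 : ⟪S (S y), y⟫_ℝ = ‖S y‖ ^ 2 := by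
    rw [← real_inner_self_eq_norm_sq]; exact hS.isSymmetric _ _
  rw [map_sub, inner_sub_left, inner_sub_right, inner_sub_right, h3,
    real_inner_self_eq_norm_sq] at h
  linarith

theorem ContinuousLinearMap.IsPositive.inner_pow_apply_pow {S : H →L[ℝ] H} (hS : S.IsPositive)
    (m k : ℕ) (x : H) : ⟪(S ^ m) x, (S ^ k) x⟫_ℝ = ⟪(S ^ (m + k)) x, x⟫_ℝ := by
  induction k generalizing m with
  | zero => simp
  | succ k ih =>
    rw [show m + (k + 1) = (m + 1) + k by ring, ← ih (m + 1), pow_succ', pow_succ' S m]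
    exact (hS.isSymmetric _ _).symm

/-- The moments ⟪Sᵐx, x⟫ decrease (even steps by contraction, odd steps by S² ≤ S) and are
nonnegative. Since ‖Sᵐx − Sᵏx‖² is a combination of moments, the orbit is Cauchy. -/
theorem ContinuousLinearMap.IsPositive.exists_tendsto_pow_apply [CompleteSpace H] {S : H →L[ℝ] H}
    (hS : S.IsPositive) (h1 : ‖S‖ ≤ 1) (x : H) :
    ∃ p, Tendsto (fun m : ℕ => (S ^ m) x) atTop (𝓝 p) := by
  set a : ℕ → ℝ := fun m => ⟪(S ^ m) x, x⟫_ℝ with ha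
  have hanti : Antitone a := by
    refine antitone_nat_of_succ_le fun m => ?_
    obtain ⟨k, rfl | rfl⟩ := m.even_or_odd'
    · have e1 : a (2 * k) = ‖(S ^ k) x‖ ^ 2 := by
        rw [← real_inner_self_eq_norm_sq, hS.inner_pow_apply_pow, two_mul]
      have e2 : a (2 * k + 1) = ⟪S ((S ^ k) x), (S ^ k) x⟫_ℝ := by
        rw [show 2 * k + 1 = (k + 1) + k by ring, ha]
        simp only
        rw [← hS.inner_pow_apply_pow, pow_succ']; rfl
      rw [e1, e2]
      refine (real_inner_le_norm _ _).trans ?_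
      have := S.le_of_opNorm_le h1 ((S ^ k) x)
      nlinarith [norm_nonneg ((S ^ k) x)]
    · have e1 : a (2 * k + 1 + 1) = ‖S ((S ^ k) x)‖ ^ 2 := by
        rw [show 2 * k + 1 + 1 = (k + 1) + (k + 1) by ring, ha]
        simp only
        rw [← hS.inner_pow_apply_pow, real_inner_self_eq_norm_sq, pow_succ' S k]; rfl
      have e2 : a (2 * k + 1) = ⟪S ((S ^ k) x), (S ^ k) x⟫_ℝ := by
        rw [show 2 * k + 1 = (k + 1) + k by ring, ha]
        simp only
        rw [← hS.inner_pow_apply_pow, pow_succ']; rfl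
      rw [e1, e2]
      exact hS.sq_norm_apply_le h1 _
  have heven (k : ℕ) : a (2 * k) = ‖(S ^ k) x‖ ^ 2 := by
    rw [← real_inner_self_eq_norm_sq, hS.inner_pow_apply_pow, two_mul]
  have hbdd : BddBelow (Set.range a) := by
    refine ⟨0, ?_⟩
    rintro _ ⟨m, rfl⟩
    refine le_trans ?_ (hanti (by lia : m ≤ 2 * m))
    rw [heven]; positivity
  have hlim := tendsto_atTop_ciInf hanti hbdd
  set L := ⨅ i, a i with hL
  have hLle (m : ℕ) : L ≤ a m := ciInf_le hbdd m
  apply cauchySeq_tendsto_of_complete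
  refine cauchySeq_of_le_tendsto_0' (fun m => √(a (2 * m) - L)) (fun m k hmk => ?_) ?_
  · refine Real.le_sqrt_of_sq_le ?_
    rw [dist_eq_norm, norm_sub_sq_real, hS.inner_pow_apply_pow, ← heven, ← heven]
    have h2 : a (2 * k) ≤ a (m + k) := hanti (by lia)
    change a (2 * m) - 2 * a (m + k) + a (2 * k) ≤ _
    linarith [hLle (2 * k)]
  · have : Tendsto (fun m : ℕ => a (2 * m)) atTop (𝓝 L) :=
      hlim.comp (tendsto_id.const_mul_atTop' two_pos)
    have h2 := (Real.continuous_sqrt.tendsto _).comp (this.sub_const L)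
    rw [sub_self, Real.sqrt_zero] at h2
    exact h2

end PositiveOperators

/-! ### Measurable selection of fixed vectors -/

section MeasurableSelection

variable {Ξ H : Type*} [MeasurableSpace Ξ] [NormedAddCommGroup H] [InnerProductSpace ℝ H]
  [SecondCountableTopology H] [MeasurableSpace H] [BorelSpace H]

theorem measurable_clm_apply {T : Ξ → H →L[ℝ] H} (hT : ∀ x, Measurable fun ξ => T ξ x)
    {g : Ξ → H} (hg : Measurable g) : Measurable fun ξ => T ξ (g ξ) := by
  have h : Measurable (Function.uncurry fun (x : H) (ξ : Ξ) => T ξ x) :=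
    measurable_uncurry_of_continuous_of_measurable (fun ξ => (T ξ).continuous) hT
  exact h.comp (hg.prodMk measurable_id)

theorem measurable_opNorm {T : Ξ → H →L[ℝ] H} (hT : ∀ x, Measurable fun ξ => T ξ x) :
    Measurable fun ξ => ‖T ξ‖ := by
  refine measurable_of_Iic fun c => ?_
  rcases lt_or_ge c 0 with hc | hc
  · convert MeasurableSet.empty
    ext ξ
    simpa using hc.trans_le (norm_nonneg _)
  · have : (fun ξ => ‖T ξ‖) ⁻¹' Set.Iic c =
        ⋂ j : ℕ, {ξ | ‖T ξ (TopologicalSpace.denseSeq H j)‖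
          ≤ c * ‖TopologicalSpace.denseSeq H j‖} := by
      ext ξ
      simp only [Set.mem_preimage, Set.mem_Iic, Set.mem_iInter, Set.mem_ofPred_eq]
      refine ⟨fun h j => (T ξ).le_of_opNorm_le h _, fun h => ?_⟩
      refine (T ξ).opNorm_le_bound hc fun x => ?_
      refine (TopologicalSpace.denseRange_denseSeq H).induction_on (p := fun x =>
        ‖T ξ x‖ ≤ c * ‖x‖) x ?_ h
      exact isClosed_le (by fun_prop) (by fun_prop)
    rw [this]
    exact MeasurableSet.iInter fun j => measurableSet_le (hT _).norm measurable_const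

theorem exists_measurable_fixed_vector [CompleteSpace H] {S : Ξ → H →L[ℝ] H}
    (hS : ∀ x, Measurable fun ξ => S ξ x) (hpos : ∀ ξ, (S ξ).IsPositive)
    (hle : ∀ ξ, ‖S ξ‖ ≤ 1) (hfix : ∀ ξ, ∃ u, u ≠ 0 ∧ S ξ u = u) :
    ∃ w : Ξ → H, Measurable w ∧ (∀ ξ, ‖w ξ‖ = 1) ∧ ∀ ξ, S ξ (w ξ) = w ξ := by
  classical
  choose p hp using fun ξ x => (hpos ξ).exists_tendsto_pow_apply (hle ξ) x
  have hpowm (m : ℕ) (x : H) : Measurable fun ξ => ((S ξ) ^ m) x := by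
    induction m with
    | zero => simp
    | succ m ih =>
      simp_rw [pow_succ']
      exact measurable_clm_apply hS ih
  have hpm (x : H) : Measurable fun ξ => p ξ x :=
    measurable_of_tendsto_metrizable (fun m => hpowm m x) (tendsto_pi_nhds.2 fun ξ => hp ξ x)
  have hpfix (ξ x) : S ξ (p ξ x) = p ξ x := by
    refine tendsto_nhds_unique (((S ξ).continuous.tendsto _).comp (hp ξ x)) ?_
    have := (hp ξ x).comp (tendsto_add_atTop_nat 1)
    refine this.congr fun m => ?_
    simp only [Function.comp_apply, pow_succ' (S ξ) m]
    rfl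
  have hex (ξ) : ∃ j, p ξ (TopologicalSpace.denseSeq H j) ≠ 0 := by
    by_contra! h
    obtain ⟨u, hu0, hu⟩ := hfix ξ
    have hpu (m : ℕ) : ((S ξ) ^ m) u = u := by
      induction m with
      | zero => simp
      | succ m ih => rw [pow_succ', mul_apply_eq_comp, ih, hu]
    -- Since u is fixed, ‖u − Sᵐd‖ = ‖Sᵐ(u − d)‖ ≤ ‖u − d‖. If Sᵐd → 0 for every d in a dense set,
    -- then ‖u‖ ≤ ‖u − y‖ for all y, and y = u gives u = 0.
    have hclosed : ∀ y, ‖u‖ ≤ ‖u - y‖ := by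
      intro y
      refine (TopologicalSpace.denseRange_denseSeq H).induction_on (p := fun y =>
        ‖u‖ ≤ ‖u - y‖) y (isClosed_le (by fun_prop) (by fun_prop)) fun j => ?_
      have h1 : Tendsto (fun m : ℕ => ‖u - ((S ξ) ^ m) (TopologicalSpace.denseSeq H j)‖) atTop
          (𝓝 ‖u - 0‖) := by
        have := hp ξ (TopologicalSpace.denseSeq H j)
        rw [h] at this
        exact (this.const_sub u).norm
      rw [sub_zero] at h1
      refine le_of_tendsto h1 (Eventually.of_forall fun m => ?_)
      conv_lhs => rw [← hpu m, ← map_sub]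
      have h2 : ‖(S ξ) ^ m‖ ≤ 1 := by
        rcases Nat.eq_zero_or_pos m with rfl | hm
        · exact ContinuousLinearMap.norm_id_le
        · exact (norm_pow_le' _ hm).trans (pow_le_one₀ (norm_nonneg _) (hle ξ))
      simpa using ((S ξ) ^ m).le_of_opNorm_le h2 (u - TopologicalSpace.denseSeq H j)
    have := hclosed u
    simp at this
    exact hu0 this
  have hN : Measurable fun ξ => Nat.find (hex ξ) :=
    measurable_find hex fun j => (hpm _) (measurableSet_singleton 0).compl
  have hjoint : Measurable fun q : Ξ × ℕ => p q.1 (TopologicalSpace.denseSeq H q.2) :=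
    measurable_from_prod_countable_left fun j => hpm (TopologicalSpace.denseSeq H j)
  have hw : Measurable fun ξ => p ξ (TopologicalSpace.denseSeq H (Nat.find (hex ξ))) :=
    hjoint.comp (measurable_id.prodMk hN)
  refine ⟨fun ξ => ‖p ξ (TopologicalSpace.denseSeq H (Nat.find (hex ξ)))‖⁻¹ •
    p ξ (TopologicalSpace.denseSeq H (Nat.find (hex ξ))), hw.norm.inv.smul hw, fun ξ => ?_,
    fun ξ => ?_⟩
  · rw [norm_smul, norm_inv, norm_norm, inv_mul_cancel₀]
    exact norm_ne_zero_iff.2 (Nat.find_spec (hex ξ))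
  · rw [map_smul, hpfix]

end MeasurableSelection

/-! ### Measurable eigenvectors by deflation -/

section SpectralSelection

variable {Ξ H : Type*} [MeasurableSpace Ξ] [NormedAddCommGroup H] [InnerProductSpace ℝ H]

theorem mem_orthogonal_span_range_iff {ι : Type*} {v : ι → H} {x : H} :
    x ∈ (Submodule.span ℝ (Set.range v))ᗮ ↔ ∀ i, ⟪v i, x⟫_ℝ = 0 := by
  rw [Submodule.mem_orthogonal]
  refine ⟨fun h i => h _ (Submodule.subset_span ⟨i, rfl⟩), fun h u hu => ?_⟩
  induction hu using Submodule.span_induction with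
  | mem y hy => obtain ⟨i, rfl⟩ := hy; exact h i
  | zero => simp
  | add y z _ _ hy hz => rw [inner_add_left, hy, hz, add_zero]
  | smul c y _ hy => rw [real_inner_smul_left, hy, mul_zero]

theorem Orthonormal.inner_sub_sum_eq_zero {ι : Type*} [Fintype ι] {v : ι → H}
    (hv : Orthonormal ℝ v) (x : H) (i : ι) : ⟪v i, x - ∑ j, ⟪v j, x⟫_ℝ • v j⟫_ℝ = 0 := by
  rw [inner_sub_right, hv.inner_right_fintype, sub_self]

theorem Orthonormal.starProjection_orthogonal_span_apply [CompleteSpace H] {ι : Type*} [Fintype ι]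
    {v : ι → H} (hv : Orthonormal ℝ v) (x : H) :
    (Submodule.span ℝ (Set.range v))ᗮ.starProjection x = x - ∑ j, ⟪v j, x⟫_ℝ • v j := by
  refine (Submodule.eq_starProjection_of_mem_orthogonal ?_ ?_)
  · exact mem_orthogonal_span_range_iff.2 (hv.inner_sub_sum_eq_zero x)
  · rw [sub_sub_cancel]
    refine Submodule.le_orthogonal_orthogonal _ (Submodule.sum_mem _ fun j _ => ?_)
    exact Submodule.smul_mem _ _ (Submodule.subset_span ⟨j, rfl⟩)

variable [SecondCountableTopology H] [MeasurableSpace H] [BorelSpace H] [CompleteSpace H]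

/-- The complement K of the known eigenvectors is T-invariant, so the compression R = QTQ agrees
with T on K. Its norm is the next eigenvalue, and normalising R reduces the problem to selecting a
fixed vector. -/
theorem exists_measurable_next_eigenvector {T : Ξ → H →L[ℝ] H}
    (hT : ∀ x, Measurable fun ξ => T ξ x) (hpos : ∀ ξ, (T ξ).IsPositive)
    (hcomp : ∀ ξ, IsCompactOperator (T ξ)) {k : ℕ} {v : Fin k → Ξ → H} {lam : Fin k → Ξ → ℝ}
    (hv : ∀ i, Measurable (v i)) (hon : ∀ ξ, Orthonormal ℝ fun i => v i ξ)
    (heig : ∀ i ξ, T ξ (v i ξ) = lam i ξ • v i ξ)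
    (hdim : ∀ ξ, ∃ x : H, x ≠ 0 ∧ ∀ i, ⟪v i ξ, x⟫_ℝ = 0) :
    ∃ (w : Ξ → H) (l : Ξ → ℝ), Measurable w ∧ Measurable l ∧ (∀ ξ, ‖w ξ‖ = 1) ∧
      (∀ i ξ, ⟪v i ξ, w ξ⟫_ℝ = 0) ∧ (∀ ξ, T ξ (w ξ) = l ξ • w ξ) ∧ (∀ ξ, 0 ≤ l ξ) ∧
      ∀ ξ x, (∀ i, ⟪v i ξ, x⟫_ℝ = 0) → ⟪T ξ x, x⟫_ℝ ≤ l ξ * ‖x‖ ^ 2 := by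
  classical
  set K : Ξ → Submodule ℝ H := fun ξ => (Submodule.span ℝ (Set.range fun i => v i ξ))ᗮ with hK
  have hKmem (ξ x) : x ∈ K ξ ↔ ∀ i, ⟪v i ξ, x⟫_ℝ = 0 := mem_orthogonal_span_range_iff
  set Q : Ξ → H →L[ℝ] H := fun ξ => (K ξ).starProjection with hQ
  have hQapp (ξ x) : Q ξ x = x - ∑ j, ⟪v j ξ, x⟫_ℝ • v j ξ :=
    (hon ξ).starProjection_orthogonal_span_apply x
  have hQm (x) : Measurable fun ξ => Q ξ x := by
    simp_rw [hQapp]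
    exact measurable_const.sub (Finset.measurable_fun_sum _ fun j _ =>
      ((hv j).inner measurable_const).smul (hv j))
  have hQmem (ξ x) : Q ξ x ∈ K ξ := Submodule.starProjection_apply_mem _ _
  have hQfix (ξ x) (hx : x ∈ K ξ) : Q ξ x = x := Submodule.starProjection_eq_self_iff.2 hx
  have hQpos (ξ) : (Q ξ).IsPositive := by
    refine ⟨Submodule.starProjection_isSymmetric _, fun x => ?_⟩
    have h := Submodule.inner_starProjection_left_eq_right (K ξ) (Q ξ x) x
    change 0 ≤ ⟪Q ξ x, x⟫_ℝ
    rw [← hQfix ξ (Q ξ x) (hQmem ξ x)]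
    change 0 ≤ ⟪(K ξ).starProjection (Q ξ x), x⟫_ℝ
    rw [h]
    exact real_inner_self_nonneg
  have hTK (ξ x) (hx : x ∈ K ξ) : T ξ x ∈ K ξ := by
    rw [hKmem] at hx ⊢
    intro i
    have := (hpos ξ).isSymmetric (v i ξ) x
    change ⟪T ξ (v i ξ), x⟫_ℝ = ⟪v i ξ, T ξ x⟫_ℝ at this
    rw [← this, heig, real_inner_smul_left, hx, mul_zero]
  set R : Ξ → H →L[ℝ] H := fun ξ => Q ξ ∘L T ξ ∘L Q ξ with hR
  have hRm (x) : Measurable fun ξ => R ξ x :=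
    measurable_clm_apply hQm (measurable_clm_apply hT (hQm x))
  have hRpos (ξ) : (R ξ).IsPositive := (hpos ξ).conj_starProjection (K ξ)
  have hRcomp (ξ) : IsCompactOperator (R ξ) := ((hcomp ξ).comp_clm (Q ξ)).clm_comp (Q ξ)
  have hRapp (ξ x) (hx : x ∈ K ξ) : R ξ x = T ξ x := by
    change Q ξ (T ξ (Q ξ x)) = T ξ x
    rw [hQfix ξ x hx, hQfix ξ _ (hTK ξ x hx)]
  have hRmem (ξ x) : R ξ x ∈ K ξ := hQmem ξ _
  -- Where R vanishes, every unit vector of K is an eigenvector for 0. Taking Q there makes the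
  -- fixed vectors of S lie in K in both cases.
  set S : Ξ → H →L[ℝ] H := fun ξ => if ‖R ξ‖ = 0 then Q ξ else ‖R ξ‖⁻¹ • R ξ with hS
  have hRnm : Measurable fun ξ => ‖R ξ‖ := measurable_opNorm hRm
  have hSm (x) : Measurable fun ξ => S ξ x := by
    have : (fun ξ => S ξ x) = fun ξ => if ‖R ξ‖ = 0 then Q ξ x else ‖R ξ‖⁻¹ • R ξ x := by
      ext1 ξ
      by_cases h : ‖R ξ‖ = 0
      · simp only [hS, h, if_true]
      · simp only [hS, h, if_false]; rfl
    rw [this]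
    exact Measurable.ite (hRnm (measurableSet_singleton 0)) (hQm x) (hRnm.inv.smul (hRm x))
  have hSmem (ξ x) : S ξ x ∈ K ξ := by
    by_cases h : ‖R ξ‖ = 0
    · simp only [hS, h, if_true]; exact hQmem ξ x
    · simp only [hS, h, if_false]; exact Submodule.smul_mem _ _ (hRmem ξ x)
  obtain ⟨w, hwm, hw1, hwfix⟩ := exists_measurable_fixed_vector hSm (fun ξ => by
      by_cases h : ‖R ξ‖ = 0
      · simp only [hS, h, if_true]; exact hQpos ξ
      · simp only [hS, h, if_false]
        exact (hRpos ξ).smul_of_nonneg (inv_nonneg.2 (norm_nonneg _)))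
    (fun ξ => by
      by_cases h : ‖R ξ‖ = 0
      · simp only [hS, h, if_true]; exact Submodule.starProjection_norm_le _
      · simp only [hS, h, if_false]
        rw [norm_smul, norm_inv, norm_norm, inv_mul_cancel₀ h])
    (fun ξ => by
      by_cases h : ‖R ξ‖ = 0
      · simp only [hS, h, if_true]
        obtain ⟨x, hx0, hx⟩ := hdim ξ
        exact ⟨x, hx0, hQfix ξ x ((hKmem ξ x).2 hx)⟩
      · simp only [hS, h, if_false]
        obtain ⟨u, hu0, hu⟩ := (hRpos ξ).exists_eigenvector_norm (hRcomp ξ)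
          (norm_ne_zero_iff.1 h)
        refine ⟨u, hu0, ?_⟩
        change ‖R ξ‖⁻¹ • R ξ u = u
        rw [hu, inv_smul_smul₀ h])
  have hwK (ξ) : w ξ ∈ K ξ := by rw [← hwfix ξ]; exact hSmem ξ _
  refine ⟨w, fun ξ => ‖R ξ‖, hwm, hRnm, hw1, fun i ξ => (hKmem ξ _).1 (hwK ξ) i, fun ξ => ?_,
    fun ξ => norm_nonneg _, fun ξ x hx => ?_⟩
  · rw [← hRapp ξ _ (hwK ξ)]
    by_cases h : ‖R ξ‖ = 0
    · simp [norm_eq_zero.1 h]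
    · have := hwfix ξ
      simp only [hS, h, if_false] at this
      change ‖R ξ‖⁻¹ • R ξ (w ξ) = w ξ at this
      conv_rhs => rw [← this]
      rw [smul_inv_smul₀ h]
  · rw [← hRapp ξ x ((hKmem ξ x).2 hx)]
    refine (real_inner_le_norm _ _).trans ?_
    have := (R ξ).le_opNorm x
    nlinarith [norm_nonneg x]

/-- A measurable family of compact positive operators on a separable Hilbert space admits
measurable eigenvectors for its largest `n` eigenvalues. -/
theorem exists_measurable_eigenvectors {T : Ξ → H →L[ℝ] H}
    (hT : ∀ x, Measurable fun ξ => T ξ x) (hpos : ∀ ξ, (T ξ).IsPositive)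
    (hcomp : ∀ ξ, IsCompactOperator (T ξ)) (n : ℕ)
    (hdim : ∀ k < n, ∀ u : Fin k → H, ∃ x : H, x ≠ 0 ∧ ∀ i, ⟪u i, x⟫_ℝ = 0) :
    ∃ (v : Fin n → Ξ → H) (lam : Fin n → Ξ → ℝ), (∀ i, Measurable (v i)) ∧
      (∀ i, Measurable (lam i)) ∧ (∀ ξ, Orthonormal ℝ fun i => v i ξ) ∧
      (∀ i ξ, T ξ (v i ξ) = lam i ξ • v i ξ) ∧ (∀ i ξ, 0 ≤ lam i ξ) ∧
      ∀ k ξ x, (∀ i < k, ⟪v i ξ, x⟫_ℝ = 0) → ⟪T ξ x, x⟫_ℝ ≤ lam k ξ * ‖x‖ ^ 2 := by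
  induction n with
  | zero =>
    exact ⟨fun i => i.elim0, fun i => i.elim0, fun i => i.elim0, fun i => i.elim0,
      fun ξ => ⟨fun i => i.elim0, fun i => i.elim0⟩, fun i => i.elim0, fun i => i.elim0,
      fun i => i.elim0⟩
  | succ n ih =>
    obtain ⟨v, lam, hv, hlam, hon, heig, h0, hmax⟩ := ih fun k hk => hdim k (by lia)
    obtain ⟨w, l, hw, hl, hw1, hvw, hTw, hl0, hlmax⟩ := exists_measurable_next_eigenvector hT hpos
      hcomp hv hon heig fun ξ => hdim n (by lia) fun i => v i ξ
    refine ⟨Fin.snoc (α := fun _ => Ξ → H) v w, Fin.snoc (α := fun _ => Ξ → ℝ) lam l,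
      ?_, ?_, ?_, ?_, ?_, ?_⟩
    · refine Fin.lastCases ?_ fun i => ?_
      · simpa using hw
      · simpa using hv i
    · refine Fin.lastCases ?_ fun i => ?_
      · simpa using hl
      · simpa using hlam i
    · intro ξ
      rw [orthonormal_iff_ite]
      have hon' := orthonormal_iff_ite.1 (hon ξ)
      refine Fin.lastCases ?_ fun i => ?_
      · refine Fin.lastCases ?_ fun j => ?_
        · simp [hw1]
        · simp [real_inner_comm, hvw, (Fin.castSucc_lt_last j).ne']
      · refine Fin.lastCases ?_ fun j => ?_
        · simp [hvw, (Fin.castSucc_lt_last i).ne]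
        · simpa using hon' i j
    · refine Fin.lastCases ?_ fun i => ?_
      · simpa using hTw
      · simpa using heig i
    · refine Fin.lastCases ?_ fun i => ?_
      · simpa using hl0
      · simpa using h0 i
    · refine Fin.lastCases ?_ fun i => ?_
      · intro ξ x hx
        simp only [Fin.snoc_last]
        refine hlmax ξ x fun i => ?_
        simpa using hx i.castSucc (Fin.castSucc_lt_last i)
      · intro ξ x hx
        simp only [Fin.snoc_castSucc]
        refine hmax i ξ x fun j hj => ?_
        simpa using hx j.castSucc (by simpa using hj)

end SpectralSelection

/-! ### Ky Fan's inequality -/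

section EigenvalueInequalities

variable {H : Type*} [NormedAddCommGroup H] [InnerProductSpace ℝ H]

theorem Orthonormal.norm_sub_sum_sq {ι : Type*} [Fintype ι] {v : ι → H}
    (hv : Orthonormal ℝ v) (x : H) :
    ‖x - ∑ j, ⟪v j, x⟫_ℝ • v j‖ ^ 2 = ‖x‖ ^ 2 - ∑ j, ⟪v j, x⟫_ℝ ^ 2 := by
  have h : ⟪∑ j, ⟪v j, x⟫_ℝ • v j, x - ∑ j, ⟪v j, x⟫_ℝ • v j⟫_ℝ = 0 := by
    rw [sum_inner]
    refine Finset.sum_eq_zero fun i _ => ?_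
    rw [real_inner_smul_left, hv.inner_sub_sum_eq_zero, mul_zero]
  rw [← real_inner_self_eq_norm_sq, inner_sub_left, h, sub_zero, inner_sub_right,
    real_inner_self_eq_norm_sq, inner_sum]
  congr 1
  refine Finset.sum_congr rfl fun i _ => ?_
  rw [real_inner_smul_right, real_inner_comm, sq]

/-- **Ky Fan's inequality**: the trace of a symmetric operator over an orthonormal family of size at
most `n` is bounded by the sum of the `n` largest eigenvalues. -/
theorem sum_inner_apply_le_sum_eigenvalues {T : H →L[ℝ] H} (hT : T.IsSymmetric) {n m : ℕ}
    (hmn : m ≤ n) {v : Fin n → H} {lam : Fin n → ℝ} (hv : Orthonormal ℝ v)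
    (heig : ∀ i, T (v i) = lam i • v i) (h0 : ∀ i, 0 ≤ lam i)
    (hmax : ∀ k x, (∀ i < k, ⟪v i, x⟫_ℝ = 0) → ⟪T x, x⟫_ℝ ≤ lam k * ‖x‖ ^ 2)
    {w : Fin m → H} (hw : Orthonormal ℝ w) : ∑ j, ⟪T (w j), w j⟫_ℝ ≤ ∑ i, lam i := by
  rcases Nat.eq_zero_or_pos n with rfl | hn
  · obtain rfl : m = 0 := by lia
    simp
  set N : Fin n := ⟨n - 1, by lia⟩ with hN
  -- The variational bound, tested on the last eigenvector, supplies the ordering.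
  have hle (i) : lam N ≤ lam i := by
    have h := hmax i (v N) fun j hj => by
      rw [orthonormal_iff_ite.1 hv, if_neg]
      rintro rfl
      have : (i : ℕ) < n := i.2
      simp only [Fin.lt_def, hN] at hj
      lia
    rwa [heig, real_inner_smul_left, real_inner_self_eq_norm_sq, hv.1, one_pow, mul_one, mul_one]
      at h
  -- In operator form: T ≤ λ_N + ∑ (λᵢ − λ_N) vᵢ⊗vᵢ. Summing over `w`, Bessel's inequality bounds
  -- each nonnegative weight λᵢ − λ_N once.
  have key (x : H) : ⟪T x, x⟫_ℝ ≤ ∑ i, (lam i - lam N) * ⟪v i, x⟫_ℝ ^ 2 + lam N * ‖x‖ ^ 2 := by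
    set y := x - ∑ j, ⟪v j, x⟫_ℝ • v j with hy
    have hxy : x = y + ∑ j, ⟪v j, x⟫_ℝ • v j := by rw [hy]; abel
    have hvy (i) : ⟪v i, y⟫_ℝ = 0 := hv.inner_sub_sum_eq_zero x i
    have h1 := hmax N y fun i _ => hvy i
    rw [hv.norm_sub_sum_sq] at h1
    have hTv (i) : ⟪T x, v i⟫_ℝ = lam i * ⟪v i, x⟫_ℝ := by
      rw [show ⟪T x, v i⟫_ℝ = ⟪x, T (v i)⟫_ℝ from hT _ _, heig, real_inner_smul_right,
        real_inner_comm]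
    have hTy : ⟪T x, y⟫_ℝ = ⟪T y, y⟫_ℝ := by
      have : ⟪T y, y⟫_ℝ = ⟪T x, y⟫_ℝ - ∑ j, ⟪v j, x⟫_ℝ * ⟪T (v j), y⟫_ℝ := by
        conv_lhs => rw [hy, map_sub, inner_sub_left, ← hy, map_sum, sum_inner]
        simp [real_inner_smul_left]
      rw [this, Finset.sum_eq_zero, sub_zero]
      intro j _
      rw [heig, real_inner_smul_left, hvy, mul_zero, mul_zero]
    have h2 : ⟪T x, x⟫_ℝ = ⟪T y, y⟫_ℝ + ∑ i, lam i * ⟪v i, x⟫_ℝ ^ 2 := by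
      conv_lhs => rw [hxy, inner_add_right, ← hxy, hTy, inner_sum]
      congr 1
      refine Finset.sum_congr rfl fun i _ => ?_
      rw [real_inner_smul_right, hTv]; ring
    have h3 : ∑ i, (lam i - lam N) * ⟪v i, x⟫_ℝ ^ 2 =
        ∑ i, lam i * ⟪v i, x⟫_ℝ ^ 2 - lam N * ∑ i, ⟪v i, x⟫_ℝ ^ 2 := by
      rw [Finset.mul_sum, ← Finset.sum_sub_distrib]
      exact Finset.sum_congr rfl fun i _ => by ring
    rw [h2, h3]
    linarith
  have hbessel (i) : ∑ j, ⟪v i, w j⟫_ℝ ^ 2 ≤ 1 := by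
    have := hw.sum_inner_products_le (v i) (s := Finset.univ)
    simpa [hv.1, real_inner_comm] using this
  calc ∑ j, ⟪T (w j), w j⟫_ℝ
      ≤ ∑ j, (∑ i, (lam i - lam N) * ⟪v i, w j⟫_ℝ ^ 2 + lam N * ‖w j‖ ^ 2) :=
        Finset.sum_le_sum fun j _ => key _
    _ = ∑ i, (lam i - lam N) * ∑ j, ⟪v i, w j⟫_ℝ ^ 2 + m * lam N := by
        rw [Finset.sum_add_distrib, Finset.sum_comm]
        simp [hw.1, Finset.mul_sum]
    _ ≤ ∑ i, (lam i - lam N) * 1 + n * lam N := by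
        gcongr with i
        · linarith [hle i]
        · exact hbessel i
        · exact h0 N
    _ = ∑ i, lam i := by simp

end EigenvalueInequalities

/-! ### Dimension counts and orthonormal completion -/

section FiniteDimensional

variable {H : Type*} [NormedAddCommGroup H] [InnerProductSpace ℝ H]

theorem exists_coeff_ne_zero_orthogonal {I J : Type*} [Fintype I] [Fintype J]
    (hIJ : Fintype.card I < Fintype.card J) (v : J → H) (u : I → H) :
    ∃ c : J → ℝ, c ≠ 0 ∧ ∀ i, ⟪u i, ∑ j, c j • v j⟫_ℝ = 0 := by
  let L : (J → ℝ) →ₗ[ℝ] (I → ℝ) :=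
    LinearMap.pi fun i => (innerₛₗ ℝ (u i)) ∘ₗ Fintype.linearCombination ℝ v
  have hker : LinearMap.ker L ≠ ⊥ := LinearMap.ker_ne_bot_of_finrank_lt (by simpa using hIJ)
  obtain ⟨c, hc, hc0⟩ := Submodule.exists_mem_ne_zero_of_ne_bot hker
  refine ⟨c, hc0, fun i => ?_⟩
  have := congrFun (LinearMap.mem_ker.1 hc) i
  simpa [L, Fintype.linearCombination_apply] using this

theorem Orthonormal.exists_ne_zero_orthogonal {n k : ℕ} {g : Fin n → H} (hg : Orthonormal ℝ g)
    (hk : k < n) (u : Fin k → H) : ∃ x : H, x ≠ 0 ∧ ∀ i, ⟪u i, x⟫_ℝ = 0 := by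
  obtain ⟨c, hc0, hc⟩ := exists_coeff_ne_zero_orthogonal (by simpa using hk) g u
  refine ⟨_, fun h => hc0 ?_, hc⟩
  exact funext (Fintype.linearIndependent_iff.1 hg.linearIndependent c h)

/-- The family `g` only ensures that the span of `g` and `v` has dimension at least n, which leaves
room to complete the part of `v` indexed by `s` to an orthonormal basis. -/
theorem Orthonormal.exists_extension {n : ℕ} {g : Fin n → H} (hg : Orthonormal ℝ g)
    {s : Set (Fin n)} {v : Fin n → H} (hv : Orthonormal ℝ (s.domRestrict v)) :
    ∃ w : Fin n → H, Orthonormal ℝ w ∧ ∀ i ∈ s, w i = v i := by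
  classical
  set E := Submodule.span ℝ (Set.range g ∪ Set.range v) with hE
  have hfin : FiniteDimensional ℝ E :=
    FiniteDimensional.span_of_finite ℝ ((Set.finite_range g).union (Set.finite_range v))
  have hgE (i) : g i ∈ E := Submodule.subset_span (Or.inl ⟨i, rfl⟩)
  have hvE (i) : v i ∈ E := Submodule.subset_span (Or.inr ⟨i, rfl⟩)
  have hnd : n ≤ Module.finrank ℝ E := by
    have hli : LinearIndependent ℝ fun i => (⟨g i, hgE i⟩ : E) := by
      refine LinearIndependent.of_comp E.subtype ?_
      exact hg.linearIndependent
    simpa using hli.fintype_card_le_finrank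
  set d := Module.finrank ℝ E with hd
  -- Basis extension needs an index type of size dim E. The padding by 0 lies outside the prescribed
  -- indices.
  let v' : Fin d → E := fun j => if h : (j : ℕ) < n then ⟨v ⟨j, h⟩, hvE _⟩ else 0
  have hv'cast (i : Fin n) : v' (Fin.castLE hnd i) = ⟨v i, hvE i⟩ := by
    simp [v']
  have hv' : Orthonormal ℝ ((Fin.castLE hnd '' s).domRestrict v') := by
    rw [orthonormal_iff_ite] at hv ⊢
    rintro ⟨_, i, hi, rfl⟩ ⟨_, j, hj, rfl⟩
    have := hv ⟨i, hi⟩ ⟨j, hj⟩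
    simpa [hv'cast, Subtype.ext_iff] using this
  obtain ⟨b, hb⟩ := hv'.exists_orthonormalBasis_extension_of_card_eq (by simp [hd])
  refine ⟨fun i => (b (Fin.castLE hnd i) : H), ?_, fun i hi => ?_⟩
  · have := b.orthonormal.comp (Fin.castLE hnd) (Fin.castLE_injective hnd)
    exact this.comp_linearIsometry E.subtypeₗᵢ
  · simp only [hb _ ⟨i, hi, rfl⟩, hv'cast]

/-- Here `w` is an orthonormal basis of the span of `f`, and the left side is the squared distance
to it. Linearly dependent `f` force m < n. -/
theorem exists_orthonormal_norm_sub_sq_ge {n : ℕ} (f : Fin n → H) :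
    ∃ m ≤ n, ∃ w : Fin m → H, Orthonormal ℝ w ∧ ∀ (y : H) (a : Fin n → ℝ),
      ‖y‖ ^ 2 - ∑ j, ⟪w j, y⟫_ℝ ^ 2 ≤ ‖y - ∑ i, a i • f i‖ ^ 2 := by
  set K := Submodule.span ℝ (Set.range f) with hK
  have hfin : FiniteDimensional ℝ K := FiniteDimensional.span_of_finite ℝ (Set.finite_range f)
  let b := stdOrthonormalBasis ℝ K
  have hw : Orthonormal ℝ fun j => (b j : H) := b.orthonormal.comp_linearIsometry K.subtypeₗᵢ
  refine ⟨Module.finrank ℝ K, by simpa using! finrank_range_le_card (R := ℝ) f, fun j => (b j : H),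
    hw, fun y a => ?_⟩
  set z := ∑ i, a i • f i with hz
  have hzK : z ∈ K := Submodule.sum_mem _ fun i _ =>
    Submodule.smul_mem _ _ (Submodule.subset_span ⟨i, rfl⟩)
  have hzs : ∑ j, ⟪(b j : H), z⟫_ℝ • (b j : H) = z := by
    have := congrArg (Subtype.val) (b.sum_repr' ⟨z, hzK⟩)
    simpa using this
  have h1 := hw.norm_sub_sum_sq (y - z)
  have h2 : y - z - ∑ j, ⟪(b j : H), y - z⟫_ℝ • (b j : H) =
      y - ∑ j, ⟪(b j : H), y⟫_ℝ • (b j : H) := by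
    simp_rw [inner_sub_right, sub_smul, Finset.sum_sub_distrib, hzs]
    abel
  rw [h2, hw.norm_sub_sum_sq] at h1
  have : 0 ≤ ∑ j, ⟪(b j : H), y - z⟫_ℝ ^ 2 := Finset.sum_nonneg fun j _ => sq_nonneg _
  linarith

end FiniteDimensional

/-! ### Covariance operators, approximation error, singular values -/

section Covariance

variable {S H : Type*} [MeasurableSpace S] [NormedAddCommGroup H] [InnerProductSpace ℝ H]

/-- The (uncentred) covariance operator `x ↦ 𝔼[⟪Y, x⟫ Y]` of a random vector `Y`. -/
noncomputable def covarianceOp (P : Measure S) (Y : S → H) : H →L[ℝ] H :=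
  ∫ ω, InnerProductSpace.rankOne ℝ (Y ω) (Y ω) ∂P

variable {P : Measure S} {Y : S → H}

theorem integrable_rankOne_self (hY : MemLp Y 2 P) :
    Integrable (fun ω => InnerProductSpace.rankOne ℝ (Y ω) (Y ω)) P := by
  have hcont : Continuous fun y : H => InnerProductSpace.rankOne ℝ y y := by
    refine ((InnerProductSpace.rankOne ℝ : H →L[ℝ] H →L⋆[ℝ] H →L[ℝ] H).continuous).clm_apply
      continuous_id
  refine (hY.integrable_norm_pow two_ne_zero).mono
    (hcont.comp_aestronglyMeasurable hY.1) (Eventually.of_forall fun ω => ?_)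
  simp [sq]

theorem memLp_inner_const (hY : MemLp Y 2 P) (x : H) : MemLp (fun ω => ⟪x, Y ω⟫_ℝ) 2 P :=
  hY.const_inner x

theorem covarianceOp_apply (hY : MemLp Y 2 P) (x : H) :
    covarianceOp P Y x = ∫ ω, ⟪Y ω, x⟫_ℝ • Y ω ∂P := by
  rw [covarianceOp, ContinuousLinearMap.integral_apply (integrable_rankOne_self hY)]
  simp

theorem inner_covarianceOp_apply [CompleteSpace H] (hY : MemLp Y 2 P) (x y : H) :
    ⟪covarianceOp P Y x, y⟫_ℝ = ∫ ω, ⟪x, Y ω⟫_ℝ * ⟪y, Y ω⟫_ℝ ∂P := by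
  have hint : Integrable (fun ω => ⟪Y ω, x⟫_ℝ • Y ω) P :=
    (integrable_rankOne_self hY).apply_continuousLinearMap x
  rw [covarianceOp_apply hY, real_inner_comm, ← integral_inner hint]
  simp [real_inner_smul_right, real_inner_comm]

theorem measurable_covarianceOp_apply {Ξ : Type*} [MeasurableSpace Ξ] [SFinite P]
    [SecondCountableTopology H] [MeasurableSpace H] [BorelSpace H] {Y : Ξ → S → H}
    (hY : Measurable fun q : Ξ × S => Y q.1 q.2) (hY2 : ∀ ξ, MemLp (Y ξ) 2 P) (x : H) :
    Measurable fun ξ => covarianceOp P (Y ξ) x := by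
  simp_rw [fun ξ => covarianceOp_apply (hY2 ξ) x]
  have : StronglyMeasurable fun q : Ξ × S => ⟪Y q.1 q.2, x⟫_ℝ • Y q.1 q.2 :=
    ((hY.inner measurable_const).smul hY).stronglyMeasurable
  exact (this.integral_prod_right').measurable

variable [CompleteSpace H]

theorem covarianceOp_isPositive (hY : MemLp Y 2 P) : (covarianceOp P Y).IsPositive := by
  refine ⟨fun x y => ?_, fun x => ?_⟩
  · change ⟪covarianceOp P Y x, y⟫_ℝ = ⟪x, covarianceOp P Y y⟫_ℝ
    rw [real_inner_comm _ x, inner_covarianceOp_apply hY, inner_covarianceOp_apply hY]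
    exact integral_congr_ae (Eventually.of_forall fun ω => mul_comm _ _)
  · change 0 ≤ ⟪covarianceOp P Y x, x⟫_ℝ
    rw [inner_covarianceOp_apply hY]
    exact integral_nonneg fun ω => mul_self_nonneg _

/-- Compact operators form a closed convex set containing the rank-one operators, so it contains
their mean under a probability measure. -/
theorem covarianceOp_isCompactOperator [IsProbabilityMeasure P] (hY : MemLp Y 2 P) :
    IsCompactOperator (covarianceOp P Y) := by
  have hmem : covarianceOp P Y ∈ compactOperator (RingHom.id ℝ) H H := by
    refine Convex.integral_mem (s := (compactOperator (RingHom.id ℝ) H H : Set (H →L[ℝ] H)))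
      ?_ ?_ (Eventually.of_forall fun ω => ?_) (integrable_rankOne_self hY)
    · exact (compactOperator (RingHom.id ℝ) H H).convex
    · exact isClosed_setOfPred_isCompactOperator
    · change IsCompactOperator (InnerProductSpace.rankOne ℝ (Y ω) (Y ω))
      rw [InnerProductSpace.rankOne_def']
      have h1 : IsCompactOperator (innerSL ℝ (Y ω)) := by
        refine ⟨Metric.closedBall 0 1, isCompact_closedBall _ _, ?_⟩
        exact (innerSL ℝ (Y ω)).continuous.continuousAt.preimage_mem_nhds
          (by simpa using Metric.closedBall_mem_nhds _ one_pos)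
      exact h1.clm_comp (ContinuousLinearMap.toSpanSingleton ℝ (Y ω))
  exact hmem

/-- For orthonormal `w` the integrand is the squared distance from `Y` to the span of `w`; this
turns approximation error into a trace. -/
theorem integral_sub_sum_sq (hY : MemLp Y 2 P) {m : ℕ} (w : Fin m → H) :
    Integrable (fun ω => ‖Y ω‖ ^ 2 - ∑ j, ⟪w j, Y ω⟫_ℝ ^ 2) P ∧
    ∫ ω, (‖Y ω‖ ^ 2 - ∑ j, ⟪w j, Y ω⟫_ℝ ^ 2) ∂P =
      ∫ ω, ‖Y ω‖ ^ 2 ∂P - ∑ j, ⟪covarianceOp P Y (w j), w j⟫_ℝ := by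
  have h1 (j) : Integrable (fun ω => ⟪w j, Y ω⟫_ℝ ^ 2) P :=
    (memLp_inner_const hY (w j)).integrable_sq
  have h2 := integrable_finsetSum Finset.univ fun j _ => h1 j
  refine ⟨(hY.integrable_norm_pow two_ne_zero).sub h2, ?_⟩
  rw [integral_sub (hY.integrable_norm_pow two_ne_zero) h2, integral_finsetSum _ fun j _ => h1 j]
  congr 1
  refine Finset.sum_congr rfl fun j _ => ?_
  rw [inner_covarianceOp_apply hY]
  simp_rw [sq]

variable {n : ℕ} {v : Fin n → H} {lam : Fin n → ℝ}

theorem lintegral_residual_eq (hY : MemLp Y 2 P) (hv : Orthonormal ℝ v)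
    (heig : ∀ i, covarianceOp P Y (v i) = lam i • v i) :
    ∫⁻ ω, ‖Y ω - ∑ i, ⟪v i, Y ω⟫_ℝ • v i‖ₑ ^ 2 ∂P =
      ENNReal.ofReal (∫ ω, ‖Y ω‖ ^ 2 ∂P - ∑ i, lam i) := by
  obtain ⟨hi, he⟩ := integral_sub_sum_sq hY v
  have hs : ∑ j, ⟪covarianceOp P Y (v j), v j⟫_ℝ = ∑ i, lam i := by
    refine Finset.sum_congr rfl fun i _ => ?_
    rw [heig, real_inner_smul_left, real_inner_self_eq_norm_sq, hv.1]; simp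
  rw [← hs, ← he, ofReal_integral_eq_lintegral_ofReal hi (Eventually.of_forall fun ω => ?_)]
  · refine lintegral_congr fun ω => ?_
    rw [← hv.norm_sub_sum_sq, ENNReal.ofReal_pow (norm_nonneg _), ofReal_norm]
  · change 0 ≤ ‖Y ω‖ ^ 2 - ∑ j, ⟪v j, Y ω⟫_ℝ ^ 2
    rw [← hv.norm_sub_sum_sq]; positivity

theorem le_lintegral_residual (hY : MemLp Y 2 P) (hv : Orthonormal ℝ v)
    (heig : ∀ i, covarianceOp P Y (v i) = lam i • v i) (h0 : ∀ i, 0 ≤ lam i)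
    (hmax : ∀ k x, (∀ i < k, ⟪v i, x⟫_ℝ = 0) → ⟪covarianceOp P Y x, x⟫_ℝ ≤ lam k * ‖x‖ ^ 2)
    (a : Fin n → S → ℝ) (f : Fin n → H) :
    ENNReal.ofReal (∫ ω, ‖Y ω‖ ^ 2 ∂P - ∑ i, lam i) ≤
      ∫⁻ ω, ‖Y ω - ∑ i, a i ω • f i‖ₑ ^ 2 ∂P := by
  obtain ⟨m, hmn, w, hw, hwle⟩ := exists_orthonormal_norm_sub_sq_ge f
  obtain ⟨hi, he⟩ := integral_sub_sum_sq hY w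
  have hky := sum_inner_apply_le_sum_eigenvalues (covarianceOp_isPositive hY).isSymmetric hmn hv
    heig h0 hmax hw
  calc ENNReal.ofReal (∫ ω, ‖Y ω‖ ^ 2 ∂P - ∑ i, lam i)
      ≤ ENNReal.ofReal (∫ ω, (‖Y ω‖ ^ 2 - ∑ j, ⟪w j, Y ω⟫_ℝ ^ 2) ∂P) := by
        rw [he]; exact ENNReal.ofReal_le_ofReal (by linarith)
    _ = ∫⁻ ω, ENNReal.ofReal (‖Y ω‖ ^ 2 - ∑ j, ⟪w j, Y ω⟫_ℝ ^ 2) ∂P := by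
        refine ofReal_integral_eq_lintegral_ofReal hi (Eventually.of_forall fun ω => ?_)
        change 0 ≤ ‖Y ω‖ ^ 2 - ∑ j, ⟪w j, Y ω⟫_ℝ ^ 2
        rw [← hw.norm_sub_sum_sq]; positivity
    _ ≤ _ := by
        refine lintegral_mono fun ω => ?_
        rw [← ofReal_norm, ← ENNReal.ofReal_pow (norm_nonneg _)]
        exact ENNReal.ofReal_le_ofReal (hwle (Y ω) fun i => a i ω)

/-- Weyl's argument for the map x ↦ ⟪x, Y⟫ into L²(P). Some x ≠ 0 in the span of v₀,…,vₖ is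
orthogonal to the k vectors v'₀,…,v'ₖ₋₁. On it the map has norm at least √λₖ‖x‖, its analogue for
`Y'` at most √λ'ₖ‖x‖, and the triangle inequality compares the two. -/
theorem sqrt_eigenvalue_le {Y' : S → H} (hY : MemLp Y 2 P) (hY' : MemLp Y' 2 P)
    {v' : Fin n → H} {lam' : Fin n → ℝ} (hv : Orthonormal ℝ v)
    (heig : ∀ i, covarianceOp P Y (v i) = lam i • v i)
    (hmax : ∀ k x, (∀ i < k, ⟪v i, x⟫_ℝ = 0) → ⟪covarianceOp P Y x, x⟫_ℝ ≤ lam k * ‖x‖ ^ 2)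
    (h0' : ∀ i, 0 ≤ lam' i)
    (hmax' : ∀ k x, (∀ i < k, ⟪v' i, x⟫_ℝ = 0) →
      ⟪covarianceOp P Y' x, x⟫_ℝ ≤ lam' k * ‖x‖ ^ 2) (k : Fin n) :
    √(lam k) ≤ √(lam' k) + √(∫ ω, ‖Y ω - Y' ω‖ ^ 2 ∂P) := by
  have hlamk (j) (hj : j ≤ k) : lam k ≤ lam j := by
    have h := hmax j (v k) fun i hi => by
      rw [orthonormal_iff_ite.1 hv, if_neg (hi.trans_le hj).ne]
    rwa [heig, real_inner_smul_left, real_inner_self_eq_norm_sq, hv.1, one_pow, mul_one, mul_one]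
      at h
  have hcard : Fintype.card {i // i < k} < Fintype.card {j // j ≤ k} :=
    Fintype.card_lt_of_injective_of_notMem
      (fun i : {i // i < k} => (⟨i.1, i.2.le⟩ : {j // j ≤ k}))
      (fun i j h => Subtype.ext (congrArg (fun t : {j // j ≤ k} => t.1) h)) (b := ⟨k, le_rfl⟩)
      (by rintro ⟨i, hi⟩; exact i.2.ne (congrArg Subtype.val hi))
  obtain ⟨c, hc0, hc⟩ := exists_coeff_ne_zero_orthogonal hcard
    (fun j : {j // j ≤ k} => v j) (fun i : {i // i < k} => v' i)
  set x := ∑ j : {j // j ≤ k}, c j • v j with hx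
  have honJ : Orthonormal ℝ fun j : {j // j ≤ k} => v j := hv.comp _ Subtype.val_injective
  have hxn : ‖x‖ ^ 2 = ∑ j, c j ^ 2 := by
    rw [← real_inner_self_eq_norm_sq, hx, honJ.inner_sum]
    simp [sq]
  have hxpos : 0 < ‖x‖ := by
    refine norm_pos_iff.2 fun h => hc0 ?_
    exact funext (Fintype.linearIndependent_iff.1 honJ.linearIndependent c h)
  have hlow : lam k * ‖x‖ ^ 2 ≤ ⟪covarianceOp P Y x, x⟫_ℝ := by
    have hTx : covarianceOp P Y x = ∑ j : {j // j ≤ k}, (c j * lam j) • v j := by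
      rw [hx, map_sum]
      exact Finset.sum_congr rfl fun j _ => by rw [map_smul, heig, smul_smul]
    rw [hTx, hxn, hx, honJ.inner_sum, Finset.mul_sum]
    refine Finset.sum_le_sum fun j _ => ?_
    have := hlamk j j.2
    simp only [conj_trivial]
    nlinarith [mul_le_mul_of_nonneg_right this (sq_nonneg (c j))]
  have hupp := hmax' k x fun i hi => hc ⟨i, hi⟩
  rw [inner_covarianceOp_apply hY] at hlow
  rw [inner_covarianceOp_apply hY'] at hupp
  have hnorm {f : S → ℝ} (hf : MemLp f 2 P) : √(∫ ω, f ω * f ω ∂P) = ‖hf.toLp f‖ := by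
    rw [← Real.sqrt_sq (norm_nonneg (hf.toLp f)), ← real_inner_self_eq_norm_sq, L2.inner_def]
    congr 1
    refine integral_congr_ae (hf.coeFn_toLp.mono fun ω h => ?_)
    simp [h, sq]
  have hA := memLp_inner_const hY x
  have hB := memLp_inner_const hY' x
  have htri : √(∫ ω, ⟪x, Y ω⟫_ℝ * ⟪x, Y ω⟫_ℝ ∂P) ≤ √(∫ ω, ⟪x, Y' ω⟫_ℝ * ⟪x, Y' ω⟫_ℝ ∂P) +
      √(∫ ω, ‖Y ω - Y' ω‖ ^ 2 ∂P) * ‖x‖ := by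
    rw [hnorm hA, hnorm hB]
    have h1 : ‖hA.toLp _ - hB.toLp _‖ ≤ √(∫ ω, ‖Y ω - Y' ω‖ ^ 2 ∂P) * ‖x‖ := by
      rw [← MemLp.toLp_sub hA hB, ← hnorm (hA.sub hB)]
      conv_rhs => rw [← Real.sqrt_sq (norm_nonneg x)]
      rw [← Real.sqrt_mul (integral_nonneg fun ω => by positivity), ← integral_mul_const]
      refine Real.sqrt_le_sqrt (integral_mono ((hA.sub hB).integrable_mul (hA.sub hB))
        (((hY.sub hY').integrable_norm_pow two_ne_zero).mul_const _) fun ω => ?_)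
      change (⟪x, Y ω⟫_ℝ - ⟪x, Y' ω⟫_ℝ) * (⟪x, Y ω⟫_ℝ - ⟪x, Y' ω⟫_ℝ) ≤ ‖Y ω - Y' ω‖ ^ 2 * ‖x‖ ^ 2
      rw [← inner_sub_right, ← sq, ← mul_pow, mul_comm, ← sq_abs]
      exact pow_le_pow_left₀ (abs_nonneg _) (abs_real_inner_le_norm _ _) 2
    calc ‖hA.toLp _‖ = ‖hB.toLp _ + (hA.toLp _ - hB.toLp _)‖ := by rw [add_sub_cancel]
      _ ≤ _ := (norm_add_le _ _).trans (by gcongr)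
  have h1 : √(lam k) * ‖x‖ ≤ √(∫ ω, ⟪x, Y ω⟫_ℝ * ⟪x, Y ω⟫_ℝ ∂P) := by
    conv_lhs => rw [← Real.sqrt_sq (norm_nonneg x)]
    rw [← Real.sqrt_mul' _ (by positivity)]
    exact Real.sqrt_le_sqrt hlow
  have h2 : √(∫ ω, ⟪x, Y' ω⟫_ℝ * ⟪x, Y' ω⟫_ℝ ∂P) ≤ √(lam' k) * ‖x‖ := by
    conv_rhs => rw [← Real.sqrt_sq (norm_nonneg x)]
    rw [← Real.sqrt_mul (h0' k)]
    exact Real.sqrt_le_sqrt hupp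
  refine le_of_mul_le_mul_right ?_ hxpos
  rw [add_mul]
  linarith

/-- The left singular vectors of a random vector `Y`: orthonormal random variables `η i` with
`√(lam i) η i = ⟪v i, Y⟫` almost surely. -/
theorem exists_orthonormal_coefficients (hY : MemLp Y 2 P) (hv : Orthonormal ℝ v)
    (heig : ∀ i, covarianceOp P Y (v i) = lam i • v i) (h0 : ∀ i, 0 ≤ lam i)
    {g : Fin n → Lp ℝ 2 P} (hg : Orthonormal ℝ g) :
    ∃ η : Fin n → S → ℝ, (∀ i, Measurable (η i)) ∧ (∀ i, MemLp (η i) 2 P) ∧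
      (∀ i j, ∫ ω, η i ω * η j ω ∂P = if i = j then 1 else 0) ∧
      ∀ i, ∀ᵐ ω ∂P, η i ω * √(lam i) = ⟪v i, Y ω⟫_ℝ := by
  have hvm (i) := memLp_inner_const hY (v i)
  have hcov (i j) : ∫ ω, ⟪v i, Y ω⟫_ℝ * ⟪v j, Y ω⟫_ℝ ∂P = if i = j then lam i else 0 := by
    rw [← inner_covarianceOp_apply hY, heig, real_inner_smul_left, orthonormal_iff_ite.1 hv]
    simp
  -- When λᵢ = 0 this is the junk value 0; such indices are excluded from `hron` and filled by the
  -- extension.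
  let r : Fin n → Lp ℝ 2 P := fun i => (√(lam i))⁻¹ • (hvm i).toLp _
  have hr (i j) : ⟪r i, r j⟫_ℝ = (√(lam i))⁻¹ * ((√(lam j))⁻¹ * if i = j then lam i else 0) := by
    rw [real_inner_smul_left, real_inner_smul_right, ← hcov, L2.inner_def]
    congr 2
    refine integral_congr_ae ?_
    filter_upwards [(hvm i).coeFn_toLp, (hvm j).coeFn_toLp] with ω h1 h2
    simp [h1, h2, mul_comm]
  have hron : Orthonormal ℝ ({i | lam i ≠ 0}.domRestrict r) := by
    rw [orthonormal_iff_ite]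
    rintro ⟨i, hi⟩ ⟨j, hj⟩
    simp only [Set.domRestrict_apply, hr, Subtype.mk.injEq]
    split_ifs with hij
    · subst hij
      rw [← mul_assoc, ← mul_inv, Real.mul_self_sqrt (h0 i), inv_mul_cancel₀ hi]
    · simp
  obtain ⟨w, hw, hwr⟩ := hg.exists_extension hron
  refine ⟨fun i => w i, fun i => (Lp.stronglyMeasurable (w i)).measurable, fun i => Lp.memLp (w i),
    fun i j => ?_, fun i => ?_⟩
  · rw [← orthonormal_iff_ite.1 hw i j, L2.inner_def]
    refine integral_congr_ae (Eventually.of_forall fun ω => ?_)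
    simp [mul_comm]
  -- If λᵢ = 0, then ⟪vᵢ, Y⟫ has zero second moment and vanishes almost surely, so any ηᵢ satisfies
  -- the identity.
  · by_cases hi : lam i = 0
    · have h1 : ∫ ω, ⟪v i, Y ω⟫_ℝ * ⟪v i, Y ω⟫_ℝ ∂P = 0 := by rw [hcov, if_pos rfl, hi]
      rw [integral_eq_zero_iff_of_nonneg (fun ω => mul_self_nonneg _)
        ((hvm i).integrable_mul (hvm i))] at h1
      filter_upwards [h1] with ω hω
      rw [hi, Real.sqrt_zero, mul_zero]
      exact (mul_self_eq_zero.1 hω).symm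
    · have hs : √(lam i) ≠ 0 := (Real.sqrt_pos.2 ((h0 i).lt_of_ne' hi)).ne'
      simp only [hwr i hi]
      filter_upwards [Lp.coeFn_smul (√(lam i))⁻¹ ((hvm i).toLp _), (hvm i).coeFn_toLp] with ω h1 h2
      rw [h1, Pi.smul_apply, h2, smul_eq_mul]
      field_simp

end Covariance

/-! ### Measurability of L²-valued maps and of representatives -/

section LpSections

variable {D : Type*} [MeasurableSpace D] {μ : Measure D}

theorem exists_orthonormal_of_disjoint {n : ℕ} {A : Fin n → Set D}
    (hA : ∀ i, MeasurableSet (A i)) (hd : Pairwise fun i j => Disjoint (A i) (A j))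
    (h0 : ∀ i, μ (A i) ≠ 0) (ht : ∀ i, μ (A i) ≠ ∞) :
    ∃ g : Fin n → Lp ℝ 2 μ, Orthonormal ℝ g := by
  refine ⟨fun i => (√(μ.real (A i)))⁻¹ • indicatorConstLp 2 (hA i) (ht i) (1 : ℝ), ?_⟩
  rw [orthonormal_iff_ite]
  intro i j
  rw [real_inner_smul_left, real_inner_smul_right,
    L2.real_inner_indicatorConstLp_one_indicatorConstLp_one (hA i) (hA j) (ht i) (ht j)]
  split_ifs with h
  · subst h
    have hpos : μ.real (A i) ≠ 0 := (measureReal_ne_zero_iff (ht i)).2 (h0 i)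
    rw [Set.inter_self, ← mul_assoc, ← mul_inv, Real.mul_self_sqrt measureReal_nonneg,
      inv_mul_cancel₀ hpos]
  · simp [(hd h).inter_eq]

theorem measurable_ofNullMeasurableSpace :
    Measurable (show NullMeasurableSpace D μ → D from fun z => z) := by
  intro s hs
  exact (show NullMeasurableSet s μ from hs.nullMeasurableSet)

/-- The fields are measurable only for the completed σ-algebra. Tonelli is applied to the
completion, and this carries the integrals back to `μ`. -/
theorem lintegral_completion {f : D → ℝ≥0∞} (hf : NullMeasurable f μ) :
    ∫⁻ z, f z ∂μ.completion = ∫⁻ z, f z ∂μ := by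
  obtain ⟨g, hg, hfg⟩ := hf.aemeasurable
  let φ : NullMeasurableSpace D μ → D := fun z => z
  have hφ : Measurable φ := measurable_ofNullMeasurableSpace
  have hmap : Measure.map φ μ.completion = μ := by
    ext s hs
    rw [Measure.map_apply hφ hs]
    rfl
  calc ∫⁻ z, f z ∂μ.completion = ∫⁻ z, g (φ z) ∂μ.completion := lintegral_congr_ae hfg
    _ = ∫⁻ z, g z ∂(Measure.map φ μ.completion) := (lintegral_map hg hφ).symm
    _ = ∫⁻ z, f z ∂μ := by rw [hmap]; exact (lintegral_congr_ae hfg).symm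

theorem sigmaFinite_completion [SigmaFinite μ] : SigmaFinite μ.completion := by
  let s : ℕ → Set D := spanningSets μ
  have hs (i) : μ (s i) < ∞ := measure_spanningSets_lt_top μ i
  have hU : ⋃ i, s i = Set.univ := iUnion_spanningSets μ
  exact ⟨⟨⟨s, fun _ => trivial, hs, hU⟩⟩⟩

theorem measurable_of_measurable_edist_denseSeq {Θ E : Type*} [MeasurableSpace Θ]
    [EMetricSpace E] [SecondCountableTopology E] [Nonempty E] [MeasurableSpace E] [BorelSpace E]
    {f : Θ → E}
    (hf : ∀ j, Measurable fun θ => edist (f θ) (TopologicalSpace.denseSeq E j)) :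
    Measurable f := by
  classical
  have hex (k : ℕ) (θ : Θ) : ∃ j, edist (f θ) (TopologicalSpace.denseSeq E j) < 2⁻¹ ^ k := by
    obtain ⟨_, ⟨j, rfl⟩, hj⟩ := EMetric.mem_closure_iff.1
      (TopologicalSpace.denseRange_denseSeq E (f θ)) (2⁻¹ ^ k)
      (ENNReal.pow_pos (by simp) k)
    exact ⟨j, hj⟩
  refine measurable_of_tendsto_metrizable
    (f := fun k θ => TopologicalSpace.denseSeq E (Nat.find (hex k θ))) (fun k => ?_) ?_
  · exact measurable_from_top.comp (measurable_find (hex k) fun j =>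
      measurableSet_lt (hf j) measurable_const)
  · refine tendsto_pi_nhds.2 fun θ => EMetric.tendsto_atTop.2 fun ε hε => ?_
    obtain ⟨K, hK⟩ := ENNReal.exists_inv_two_pow_lt hε.ne'
    refine ⟨K, fun k hk => ?_⟩
    rw [edist_comm]
    refine (Nat.find_spec (hex k θ)).trans_le (le_trans ?_ hK.le)
    exact pow_le_pow_right_of_le_one' (by simp) hk

/-- The elements of a separable `L²` space admit jointly measurable representatives. -/
theorem exists_measurable_representative [SecondCountableTopology (Lp ℝ 2 μ)]
    [MeasurableSpace (Lp ℝ 2 μ)] [BorelSpace (Lp ℝ 2 μ)] :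
    ∃ Φ : Lp ℝ 2 μ → D → ℝ, (Measurable fun p : Lp ℝ 2 μ × D => Φ p.1 p.2) ∧
      ∀ f, Φ f =ᵐ[μ] f := by
  classical
  let d := TopologicalSpace.denseSeq (Lp ℝ 2 μ)
  have hex (k : ℕ) (f : Lp ℝ 2 μ) : ∃ j, edist f (d j) < 2⁻¹ ^ (k + 1) := by
    obtain ⟨_, ⟨j, rfl⟩, hj⟩ := EMetric.mem_closure_iff.1
      (TopologicalSpace.denseRange_denseSeq _ f) (2⁻¹ ^ (k + 1))
      (ENNReal.pow_pos (by simp) _)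
    exact ⟨j, hj⟩
  let a (k : ℕ) (f : Lp ℝ 2 μ) : Lp ℝ 2 μ := d (Nat.find (hex k f))
  have hN (k : ℕ) : Measurable fun f => Nat.find (hex k f) :=
    measurable_find (hex k) fun j => measurableSet_lt (by fun_prop) measurable_const
  have hd : Measurable fun q : ℕ × D => d q.1 q.2 :=
    measurable_from_prod_countable_right fun j => (Lp.stronglyMeasurable (d j)).measurable
  have ham (k : ℕ) : Measurable fun p : Lp ℝ 2 μ × D => a k p.1 p.2 :=
    hd.comp (((hN k).comp measurable_fst).prodMk measurable_snd)
  have hclose (k f) : edist f (a k f) < 2⁻¹ ^ (k + 1) := Nat.find_spec (hex k f)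
  refine ⟨fun f z => limUnder atTop fun k => a k f z,
    (StronglyMeasurable.limUnder fun k => (ham k).stronglyMeasurable).measurable, fun f => ?_⟩
  have hlim : Tendsto (fun k => a k f) atTop (𝓝 f) := by
    refine EMetric.tendsto_atTop.2 fun ε hε => ?_
    obtain ⟨K, hK⟩ := ENNReal.exists_inv_two_pow_lt hε.ne'
    refine ⟨K, fun k hk => ?_⟩
    rw [edist_comm]
    refine (hclose k f).trans_le (le_trans ?_ hK.le)
    exact pow_le_pow_right_of_le_one' (by simp) (by lia)
  -- The geometric rate gives almost everywhere convergence of the whole sequence; the subsequence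
  -- only identifies the limit as f.
  obtain ⟨ns, hns, hsub⟩ := (tendstoInMeasure_of_tendsto_Lp hlim).exists_seq_tendsto_ae
  have hconv : ∀ᵐ z ∂μ, ∃ l, Tendsto (fun k => a k f z) atTop (𝓝 l) := by
    refine Lp.ae_tendsto_of_cauchy_eLpNorm (p := 2) (fun k => Lp.aestronglyMeasurable _) (by norm_num)
      (B := fun k => 2⁻¹ ^ k) ?_ fun N n m hn hm => ?_
    · rw [ENNReal.tsum_geometric]; simp
    · rw [← Lp.edist_def]
      calc edist (a n f) (a m f) ≤ edist (a n f) f + edist f (a m f) := edist_triangle _ _ _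
        _ < 2⁻¹ ^ (n + 1) + 2⁻¹ ^ (m + 1) := by
            refine ENNReal.add_lt_add ?_ (hclose m f)
            rw [edist_comm]; exact hclose n f
        _ ≤ 2⁻¹ ^ (N + 1) + 2⁻¹ ^ (N + 1) :=
            add_le_add (pow_le_pow_right_of_le_one' (by simp) (by lia))
              (pow_le_pow_right_of_le_one' (by simp) (by lia))
        _ = 2⁻¹ ^ N := by rw [pow_succ, ← mul_add, ENNReal.inv_two_add_inv_two, mul_one]
  filter_upwards [hsub, hconv] with z h1 ⟨l, hl⟩
  rw [hl.limUnder_eq]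
  exact tendsto_nhds_unique (hl.comp hns.tendsto_atTop) h1

theorem eLpNorm_two_eq {E : Type*} [NormedAddCommGroup E] (f : D → E) :
    eLpNorm f 2 μ = (∫⁻ z, ‖f z‖ₑ ^ 2 ∂μ) ^ (2⁻¹ : ℝ) := by
  rw [eLpNorm_eq_lintegral_rpow_enorm_toReal two_ne_zero ENNReal.ofNat_ne_top]
  simp

theorem eLpNorm_two_lt_top_iff {E : Type*} [NormedAddCommGroup E] (f : D → E) :
    eLpNorm f 2 μ < ∞ ↔ ∫⁻ z, ‖f z‖ₑ ^ 2 ∂μ < ∞ := by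
  rw [eLpNorm_two_eq]
  exact ENNReal.rpow_lt_top_iff_of_pos (by norm_num)

theorem lintegral_enorm_sq_eq_of_ae_eq {f : D → ℝ} {h : Lp ℝ 2 μ} (hf : f =ᵐ[μ] h) :
    ∫⁻ z, ‖f z‖ₑ ^ 2 ∂μ = ‖h‖ₑ ^ 2 := by
  rw [Lp.enorm_def, ← eLpNorm_congr_ae hf, eLpNorm_two_eq, ← ENNReal.rpow_natCast,
    ← ENNReal.rpow_mul]
  norm_num

open Classical in
/-- The element of `L²` defined by a function, and zero if it is not square-integrable. -/
noncomputable def toL2 (μ : Measure D) (f : D → ℝ) : Lp ℝ 2 μ :=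
  if h : MemLp f 2 μ then h.toLp f else 0

theorem toL2_of_memLp {f : D → ℝ} (h : MemLp f 2 μ) : toL2 μ f = h.toLp f := dif_pos h

variable {Θ : Type*} [MeasurableSpace Θ] {F : Θ → D → ℝ}

theorem measurable_lintegral_sq_sub [SigmaFinite μ]
    (hF : Measurable fun p : Θ × NullMeasurableSpace D μ => F p.1 p.2) {g : D → ℝ}
    (hg : Measurable g) : Measurable fun θ => ∫⁻ z, ‖F θ z - g z‖ₑ ^ 2 ∂μ := by
  have hg' : Measurable (show NullMeasurableSpace D μ → ℝ from g) :=
    hg.comp measurable_ofNullMeasurableSpace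
  have hG : Measurable fun p : Θ × NullMeasurableSpace D μ => ‖F p.1 p.2 - g p.2‖ₑ ^ 2 :=
    ((hF.sub (hg'.comp measurable_snd)).enorm).pow_const 2
  have := sigmaFinite_completion (μ := μ)
  have h : Measurable fun θ => ∫⁻ z, ‖F θ z - g z‖ₑ ^ 2 ∂μ.completion := hG.lintegral_prod_right'
  have heq (θ) : ∫⁻ z, ‖F θ z - g z‖ₑ ^ 2 ∂μ.completion = ∫⁻ z, ‖F θ z - g z‖ₑ ^ 2 ∂μ :=
    lintegral_completion (hG.comp measurable_prodMk_left)
  simpa only [heq] using h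

theorem aestronglyMeasurable_section
    (hF : Measurable fun p : Θ × NullMeasurableSpace D μ => F p.1 p.2) (θ : Θ) :
    AEStronglyMeasurable (F θ) μ := by
  have h : NullMeasurable (F θ) μ := hF.comp measurable_prodMk_left
  exact h.aemeasurable.aestronglyMeasurable

theorem memLp_section_iff
    (hF : Measurable fun p : Θ × NullMeasurableSpace D μ => F p.1 p.2) (θ : Θ) :
    MemLp (F θ) 2 μ ↔ ∫⁻ z, ‖F θ z‖ₑ ^ 2 ∂μ < ∞ := by
  rw [MemLp, and_iff_right (aestronglyMeasurable_section hF θ),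
    eLpNorm_two_lt_top_iff]

/-- Distances to a dense sequence determine measurability, and each is a Tonelli integral in the
parameter. -/
theorem measurable_toL2_section [SigmaFinite μ] [SecondCountableTopology (Lp ℝ 2 μ)]
    [MeasurableSpace (Lp ℝ 2 μ)] [BorelSpace (Lp ℝ 2 μ)]
    (hF : Measurable fun p : Θ × NullMeasurableSpace D μ => F p.1 p.2) :
    Measurable fun θ => toL2 μ (F θ) := by
  classical
  refine measurable_of_measurable_edist_denseSeq fun j => ?_
  set h := TopologicalSpace.denseSeq (Lp ℝ 2 μ) j
  have hgood : MeasurableSet {θ | MemLp (F θ) 2 μ} := by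
    simp_rw [memLp_section_iff hF]
    have := measurable_lintegral_sq_sub hF (g := fun _ => 0) measurable_const
    simp only [sub_zero] at this
    exact measurableSet_lt this measurable_const
  have heq : (fun θ => edist (toL2 μ (F θ)) h) = fun θ => if MemLp (F θ) 2 μ then
      (∫⁻ z, ‖F θ z - h z‖ₑ ^ 2 ∂μ) ^ (2⁻¹ : ℝ) else edist 0 h := by
    ext1 θ
    split_ifs with hθ
    · rw [toL2_of_memLp hθ, ← eLpNorm_two_eq, Lp.edist_def]
      exact eLpNorm_congr_ae (hθ.coeFn_toLp.sub (EventuallyEq.refl _ _))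
    · rw [toL2, dif_neg hθ]
  rw [heq]
  exact Measurable.ite hgood ((measurable_lintegral_sq_sub hF
    (Lp.stronglyMeasurable h).measurable).pow_const _) measurable_const

end LpSections

/-! ### Lebesgue measure on the domain -/

section VolumeSubtype

variable {E : Type*} [MeasureSpace E] {Ω : Set E}

theorem volume_subtype_apply (hΩ : NullMeasurableSet Ω (volume : Measure E)) {s : Set Ω}
    (hs : MeasurableSet s) : volume s = volume (Subtype.val '' s : Set E) :=
  Measure.comap_apply₀ _ _ Subtype.val_injective
    (fun _ h => Measure.MeasurableSet.nullMeasurableSet_subtype_coe hΩ h) hs.nullMeasurableSet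

theorem sigmaFinite_volume_subtype [SigmaFinite (volume : Measure E)]
    (hΩ : NullMeasurableSet Ω (volume : Measure E)) : SigmaFinite (volume : Measure Ω) := by
  refine ⟨⟨⟨fun i => Subtype.val ⁻¹' spanningSets (volume : Measure E) i, fun _ => trivial,
    fun i => ?_, ?_⟩⟩⟩
  · rw [volume_preimage_coe hΩ (measurableSet_spanningSets _ i)]
    exact (measure_mono Set.inter_subset_left).trans_lt (measure_spanningSets_lt_top _ i)
  · rw [← Set.preimage_iUnion, iUnion_spanningSets, Set.preimage_univ]

/-- The support has null complement, so an atomless nonzero measure has infinite support. Disjoint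
small neighbourhoods of n of its points serve. -/
theorem exists_disjoint_subsets_pos_measure {E : Type*} [PseudoEMetricSpace E] [T2Space E]
    [SecondCountableTopology E] [MeasurableSpace E] [BorelSpace E] {μ : Measure E}
    [NullSingletonClass μ] [IsLocallyFiniteMeasure μ] (h0 : μ ≠ 0) (n : ℕ) :
    ∃ A : Fin n → Set E, (∀ i, MeasurableSet (A i)) ∧
      (Pairwise fun i j => Disjoint (A i) (A j)) ∧ (∀ i, μ (A i) ≠ 0) ∧ ∀ i, μ (A i) ≠ ∞ := by
  have hinf : μ.support.Infinite := by
    intro hfin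
    have h1 : μ μ.support = 0 := hfin.measure_zero μ
    refine h0 (Measure.measure_univ_eq_zero.1 ?_)
    rw [← Set.union_compl_self μ.support]
    exact measure_union_null h1 Measure.measure_compl_support
  obtain ⟨t, hts, htn⟩ := hinf.exists_subset_card_eq n
  obtain ⟨U, hU, hUd⟩ := t.finite_toSet.t2_separation
  let e : Fin n ≃ t := (Fintype.equivFinOfCardEq (by simpa using htn)).symm
  have hx (i) : ∃ V : Set E, V ⊆ U (e i) ∧ (e i : E) ∈ V ∧ IsOpen V ∧ μ V < ∞ := by
    obtain ⟨W, hW, hWo, hWf⟩ := μ.exists_isOpen_measure_lt_top (e i : E)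
    exact ⟨U (e i) ∩ W, Set.inter_subset_left, ⟨(hU _).1, hW⟩, (hU _).2.inter hWo,
      (measure_mono Set.inter_subset_right).trans_lt hWf⟩
  choose V hVU hxV hVo hVf using hx
  refine ⟨V, fun i => (hVo i).measurableSet, fun i j hij => ?_, fun i => ?_, fun i => (hVf i).ne⟩
  · refine (hUd (e i).2 (e j).2 fun h => hij (e.injective (Subtype.ext h))).mono (hVU i) (hVU j)
  · exact ((Measure.mem_support_iff_forall _).1 (hts (e i).2) _ ((hVo i).mem_nhds (hxV i))).ne'

end VolumeSubtype

/-! ### Random fields as random vectors in L² -/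

section RandomFields

variable {D S : Type*} [MeasureSpace D] [MeasurableSpace S] {P : Measure S}

theorem toL2_ae_eq {f : D → ℝ} (hf : MemLp f 2 (volume : Measure D)) :
    toL2 volume f =ᵐ[volume] f := by
  rw [toL2_of_memLp hf]
  exact hf.coeFn_toLp

theorem meanSquare_sub_eq {X X' : D → S → ℝ}
    (hX : ∀ᵐ ω ∂P, MemLp (fun z => X z ω) 2 (volume : Measure D))
    (hX' : ∀ᵐ ω ∂P, MemLp (fun z => X' z ω) 2 (volume : Measure D)) :
    meanSquare P (fun z ω => X z ω - X' z ω) =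
      ∫⁻ ω, ‖toL2 volume (fun z => X z ω) - toL2 volume (fun z => X' z ω)‖ₑ ^ 2 ∂P := by
  refine lintegral_congr_ae ?_
  filter_upwards [hX, hX'] with ω h h'
  refine lintegral_enorm_sq_eq_of_ae_eq ?_
  filter_upwards [Lp.coeFn_sub (toL2 volume fun z => X z ω) (toL2 volume fun z => X' z ω),
    toL2_ae_eq h, toL2_ae_eq h'] with z h1 h2 h3
  rw [h1, Pi.sub_apply, h2, h3]

theorem toL2_sum {n : ℕ} (c : Fin n → ℝ) {f : Fin n → D → ℝ}
    (hf : ∀ i, MemLp (f i) 2 (volume : Measure D)) :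
    toL2 volume (fun z => ∑ i, c i * f i z) = ∑ i, c i • toL2 volume (f i) := by
  have hm : MemLp (fun z => ∑ i, c i * f i z) 2 (volume : Measure D) :=
    memLp_finsetSum _ fun i _ => (hf i).const_mul (c i)
  refine Lp.ext ((toL2_ae_eq hm).trans ?_)
  refine EventuallyEq.trans ?_ (Lp.coeFn_finsetSum _ _).symm
  have h : ∀ i, ∀ᵐ z, (c i • toL2 volume (f i) : Lp ℝ 2 (volume : Measure D)) z = c i * f i z := by
    intro i
    filter_upwards [Lp.coeFn_smul (c i) (toL2 volume (f i)), toL2_ae_eq (hf i)] with z h1 h2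
    rw [h1, Pi.smul_apply, h2, smul_eq_mul]
  filter_upwards [ae_all_iff.2 h] with z hz
  simp [hz]

theorem meanSquare_sub_sum_eq {X : D → S → ℝ}
    (hX : ∀ᵐ ω ∂P, MemLp (fun z => X z ω) 2 (volume : Measure D)) {n : ℕ} (a : Fin n → S → ℝ)
    {f : Fin n → D → ℝ} (hf : ∀ i, MemLp (f i) 2 (volume : Measure D)) :
    meanSquare P (fun z ω => X z ω - ∑ i, a i ω * f i z) =
      ∫⁻ ω, ‖toL2 volume (fun z => X z ω) - ∑ i, a i ω • toL2 volume (f i)‖ₑ ^ 2 ∂P := by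
  rw [meanSquare_sub_eq hX (Eventually.of_forall fun ω =>
    memLp_finsetSum _ fun i _ => (hf i).const_mul (a i ω))]
  simp_rw [toL2_sum _ hf]

theorem exists_optimal_rank_approximation {Ξ : Type*} [MeasurableSpace Ξ]
    [SigmaFinite (volume : Measure D)] [MeasurableSpace.CountablyGenerated D]
    [IsProbabilityMeasure P] {n : ℕ} {gD : Fin n → Lp ℝ 2 (volume : Measure D)}
    (hgD : Orthonormal ℝ gD) {gP : Fin n → Lp ℝ 2 P} (hgP : Orthonormal ℝ gP)
    (X : Ξ → D → S → ℝ)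
    (hX : Measurable fun p : Ξ × NullMeasurableSpace D (volume : Measure D) × S =>
      X p.1 p.2.1 p.2.2)
    (hX2 : ∀ ξ, meanSquare P (X ξ) < ∞) :
    ∃ (s : Fin n → Ξ → ℝ) (v : Fin n → Ξ → D → ℝ) (η : Ξ → Fin n → S → ℝ),
      (∀ i, Measurable (s i)) ∧
      (∀ i ξ, 0 ≤ s i ξ) ∧
      (∀ i, Measurable fun p : Ξ × D => v i p.1 p.2) ∧
      (∀ ξ i, Measurable (η ξ i)) ∧
      (∀ ξ i, MemLp (η ξ i) 2 P) ∧
      (∀ ξ i, MemLp (v i ξ) 2 (volume : Measure D)) ∧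
      (∀ ξ i j, ∫ ω, η ξ i ω * η ξ j ω ∂P = if i = j then 1 else 0) ∧
      (∀ ξ i j, ∫ z : D, v i ξ z * v j ξ z = if i = j then 1 else 0) ∧
      (∀ ξ, meanSquare P (fun z ω => X ξ z ω - ∑ i, η ξ i ω * s i ξ * v i ξ z) =
        ⨅ Z ∈ rankFields D P n, meanSquare P (fun z ω => X ξ z ω - Z z ω)) ∧
      (∀ _ : TopologicalSpace Ξ,
        (∀ ξ₀, Tendsto (fun ξ => meanSquare P (fun z ω => X ξ z ω - X ξ₀ z ω)) (𝓝 ξ₀) (𝓝 0)) →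
        ∀ i, Continuous (s i)) := by
  have : Fact ((2 : ℝ≥0∞) ≠ ∞) := ⟨by norm_num⟩
  borelize ↥(Lp ℝ 2 (volume : Measure D))
  have hF : Measurable fun p : (Ξ × S) × NullMeasurableSpace D (volume : Measure D) =>
      X p.1.1 p.2 p.1.2 :=
    hX.comp ((measurable_fst.comp measurable_fst).prodMk
      (measurable_snd.prodMk (measurable_snd.comp measurable_fst)))
  set Y : Ξ → S → Lp ℝ 2 (volume : Measure D) := fun ξ ω => toL2 volume fun z => X ξ z ω with hY
  have hYm : Measurable fun q : Ξ × S => Y q.1 q.2 := measurable_toL2_section hF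
  have hgood (ξ) : ∀ᵐ ω ∂P, MemLp (fun z => X ξ z ω) 2 (volume : Measure D) := by
    have h1 := measurable_lintegral_sq_sub (F := fun (q : Ξ × S) z => X q.1 z q.2) hF
      (g := fun _ => 0) measurable_const
    simp only [sub_zero] at h1
    filter_upwards [ae_lt_top (h1.comp (measurable_prodMk_left (x := ξ))) (hX2 ξ).ne] with ω hω
    exact (memLp_section_iff (F := fun (q : Ξ × S) z => X q.1 z q.2) hF (ξ, ω)).2 hω
  have hYL (ξ) : MemLp (Y ξ) 2 P := by
    refine ⟨(hYm.comp measurable_prodMk_left).aestronglyMeasurable, ?_⟩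
    rw [eLpNorm_two_lt_top_iff]
    refine lt_of_eq_of_lt (lintegral_congr_ae ?_) (hX2 ξ)
    filter_upwards [hgood ξ] with ω hω
    exact (lintegral_enorm_sq_eq_of_ae_eq (toL2_ae_eq hω).symm).symm
  obtain ⟨v, lam, hvm, hlamm, hon, heig, h0, hmax⟩ := exists_measurable_eigenvectors
    (measurable_covarianceOp_apply hYm hYL) (fun ξ => covarianceOp_isPositive (hYL ξ))
    (fun ξ => covarianceOp_isCompactOperator (hYL ξ)) n
    fun k hk u => hgD.exists_ne_zero_orthogonal hk u
  -- The η are chosen separately for each ξ, with no measurability in ξ.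
  choose η hηm hηL hηon hη using fun ξ => exists_orthonormal_coefficients (hYL ξ) (hon ξ)
    (fun i => heig i ξ) (fun i => h0 i ξ) hgP
  obtain ⟨Φ, hΦm, hΦ⟩ := exists_measurable_representative (μ := (volume : Measure D))
  have hvL (ξ i) : MemLp (Φ (v i ξ)) 2 (volume : Measure D) :=
    (memLp_congr_ae (hΦ _)).2 (Lp.memLp _)
  have htoL2 (ξ i) : toL2 volume (Φ (v i ξ)) = v i ξ :=
    Lp.ext ((toL2_ae_eq (hvL ξ i)).trans (hΦ _))
  refine ⟨fun i ξ => √(lam i ξ), fun i ξ => Φ (v i ξ), η, fun i => (hlamm i).sqrt,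
    fun i ξ => Real.sqrt_nonneg _, fun i => ?_, hηm, hηL, hvL, hηon, fun ξ i j => ?_, fun ξ => ?_,
    fun _ hcont i => ?_⟩
  · exact hΦm.comp (((hvm i).comp measurable_fst).prodMk measurable_snd)
  · rw [← orthonormal_iff_ite.1 (hon ξ) i j, L2.inner_def]
    refine integral_congr_ae ?_
    filter_upwards [hΦ (v i ξ), hΦ (v j ξ)] with z h1 h2
    simp [h1, h2, mul_comm]
  · have happrox : meanSquare P (fun z ω => X ξ z ω - ∑ i, η ξ i ω * √(lam i ξ) * Φ (v i ξ) z) =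
        ENNReal.ofReal (∫ ω, ‖Y ξ ω‖ ^ 2 ∂P - ∑ i, lam i ξ) := by
      rw [meanSquare_sub_sum_eq (hgood ξ) (fun i ω => η ξ i ω * √(lam i ξ)) (hvL ξ),
        ← lintegral_residual_eq (hYL ξ) (hon ξ) fun i => heig i ξ]
      refine lintegral_congr_ae ?_
      filter_upwards [ae_all_iff.2 (hη ξ)] with ω hω
      simp only [hω, htoL2, hY]
    refine le_antisymm (le_iInf₂ ?_) (iInf₂_le (fun z ω => ∑ i, η ξ i ω * √(lam i ξ) * Φ (v i ξ) z)
      ⟨fun i ω => η ξ i ω * √(lam i ξ), fun i => Φ (v i ξ),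
        fun i => (hηL ξ i).mul_const _, hvL ξ, rfl⟩)
    rintro _ ⟨a, f, -, hf, rfl⟩
    rw [happrox, meanSquare_sub_sum_eq (hgood ξ) a hf]
    exact le_lintegral_residual (hYL ξ) (hon ξ) (fun i => heig i ξ) (fun i => h0 i ξ)
      (fun k x => hmax k ξ x) a _
  · have hdist (ξ ξ') : √(lam i ξ) ≤ √(lam i ξ') + √(∫ ω, ‖Y ξ ω - Y ξ' ω‖ ^ 2 ∂P) :=
      sqrt_eigenvalue_le (hYL ξ) (hYL ξ') (hon ξ) (fun i => heig i ξ) (fun k x => hmax k ξ x)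
        (fun i => h0 i ξ') (fun k x => hmax k ξ' x) i
    have hms (ξ ξ') : ∫ ω, ‖Y ξ ω - Y ξ' ω‖ ^ 2 ∂P =
        (meanSquare P fun z ω => X ξ z ω - X ξ' z ω).toReal := by
      rw [meanSquare_sub_eq (hgood ξ) (hgood ξ'),
        integral_eq_lintegral_of_nonneg_ae (f := fun ω => ‖Y ξ ω - Y ξ' ω‖ ^ 2)
        (Eventually.of_forall fun ω => by positivity)
        (((hYL ξ).sub (hYL ξ')).integrable_norm_pow two_ne_zero).1]
      simp_rw [ENNReal.ofReal_pow (norm_nonneg _), ofReal_norm, hY]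
    refine continuous_iff_continuousAt.2 fun ξ₀ => ?_
    have hlim : Tendsto (fun ξ => √(∫ ω, ‖Y ξ ω - Y ξ₀ ω‖ ^ 2 ∂P)) (𝓝 ξ₀) (𝓝 0) := by
      simp_rw [hms]
      have h1 := (Real.continuous_sqrt.tendsto _).comp
        ((ENNReal.tendsto_toReal ENNReal.zero_ne_top).comp (hcont ξ₀))
      rwa [ENNReal.toReal_zero, Real.sqrt_zero] at h1
    refine tendsto_iff_dist_tendsto_zero.2 (squeeze_zero (fun _ => dist_nonneg) (fun ξ => ?_) hlim)
    have h1 := hdist ξ ξ₀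
    have h2 := hdist ξ₀ ξ
    simp_rw [norm_sub_rev (Y ξ₀ _)] at h2
    rw [Real.dist_eq, abs_le]
    constructor <;> linarith

end RandomFields

theorem corollary4p1 {Ξ S : Type*} [MeasurableSpace Ξ] [MeasurableSpace S]
    (P : Measure S) [IsProbabilityMeasure P]
    {d : ℕ} (hd : 0 < d)
    (Ω : Set (EuclideanSpace ℝ (Fin d)))
    -- `Ω` is Lebesgue measurable and not negligible
    (hΩ : NullMeasurableSet Ω volume) (hΩ0 : volume Ω ≠ 0)
    (n : ℕ)
    -- there are `n` pairwise disjoint events of positive probability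
    (hP : ∃ A : Fin n → Set S,
      (∀ i, MeasurableSet (A i)) ∧ Pairwise (fun i j => Disjoint (A i) (A j)) ∧ ∀ i, P (A i) ≠ 0)
    (X : Ξ → Ω → S → ℝ)
    -- joint measurability, with the Lebesgue sigma-algebra on `Ω`
    (hX : Measurable fun p : Ξ × NullMeasurableSpace Ω (volume : Measure Ω) × S =>
      X p.1 p.2.1 p.2.2)
    (hX2 : ∀ ξ, meanSquare P (X ξ) < ∞) :
    ∃ (s : Fin n → Ξ → ℝ) (v : Fin n → Ξ → Ω → ℝ) (η : Ξ → Fin n → S → ℝ),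
      (∀ i, Measurable (s i)) ∧
      (∀ i ξ, 0 ≤ s i ξ) ∧
      (∀ i, Measurable fun p : Ξ × Ω => v i p.1 p.2) ∧
      (∀ ξ i, Measurable (η ξ i)) ∧
      (∀ ξ i, MemLp (η ξ i) 2 P) ∧
      (∀ ξ i, MemLp (v i ξ) 2 (volume : Measure Ω)) ∧
      (∀ ξ i j, ∫ ω, η ξ i ω * η ξ j ω ∂P = if i = j then 1 else 0) ∧
      (∀ ξ i j, ∫ z : Ω, v i ξ z * v j ξ z = if i = j then 1 else 0) ∧
      (∀ ξ, meanSquare P (fun z ω => X ξ z ω - ∑ i, η ξ i ω * s i ξ * v i ξ z) =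
        ⨅ Z ∈ rankFields Ω P n, meanSquare P (fun z ω => X ξ z ω - Z z ω)) ∧
      (∀ _ : TopologicalSpace Ξ,
        (∀ ξ₀, Tendsto (fun ξ => meanSquare P (fun z ω => X ξ z ω - X ξ₀ z ω)) (𝓝 ξ₀) (𝓝 0)) →
        ∀ i, Continuous (s i)) := by
  obtain ⟨A, hA, hAd, hA0⟩ := hP
  obtain ⟨gP, hgP⟩ := exists_orthonormal_of_disjoint hA hAd hA0 fun i => measure_ne_top P _
  have : SigmaFinite (volume : Measure Ω) := sigmaFinite_volume_subtype hΩ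
  -- Positive dimension is what makes Lebesgue measure atomless.
  have : Nonempty (Fin d) := ⟨⟨0, hd⟩⟩
  have : NullSingletonClass (volume : Measure Ω) := by
    refine ⟨fun x => ?_⟩
    rw [volume_subtype_apply hΩ (measurableSet_singleton x), Set.image_singleton]
    exact measure_singleton _
  have : IsLocallyFiniteMeasure (volume : Measure Ω) := by
    refine ⟨fun x => ⟨Subtype.val ⁻¹' Metric.ball (x : EuclideanSpace ℝ (Fin d)) 1,
      (Metric.isOpen_ball.preimage continuous_subtype_val).mem_nhds (by simp), ?_⟩⟩
    rw [volume_preimage_coe hΩ measurableSet_ball]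
    exact (measure_mono Set.inter_subset_left).trans_lt measure_ball_lt_top
  have hne : (volume : Measure Ω) ≠ 0 := by
    intro h
    refine hΩ0 ?_
    have h1 := volume_subtype_apply hΩ MeasurableSet.univ
    rwa [h, Measure.coe_zero, Pi.zero_apply, Set.image_univ, Subtype.range_coe, eq_comm] at h1
  obtain ⟨B, hB, hBd, hB0, hBt⟩ := exists_disjoint_subsets_pos_measure hne n
  obtain ⟨gD, hgD⟩ := exists_orthonormal_of_disjoint hB hBd hB0 hBt
  exact exists_optimal_rank_approximation hgD hgP X hX hX2
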